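/- Let $\lambda,a\in\mathbb R$ with $|\lambda|<1$, put $\beta=\lambda+a$, and let $\Phi(\tau)=-1$ for $\tau<-1$, $\Phi(\tau)=\tau$ for $|\tau|\le 1$, $\Phi(\tau)=1$ for $\tau>1$. Consider on the strip $L=\{(x,s):x\in\mathbb R,\ |s|\le1\}$ the dynamical system $$x_{n+1}=\lambda x_n+a s_n,\qquad s_{n+1}=\Phi(s_n+x_{n+1}-x_n).$$ Its equilibrium points form the segment $EF=\{(x,s): x=\tfrac{as}{1-\lambda},\ -1\le s\le 1\}$ with end points $E=(\tfrac{a}{1-\lambda},1)$ and $F=-E$. Let $Q=(-\tfrac{a}{1+\lambda},1)$. Stable means Lyapunov stable in $L$ and unstable means not stable. An equilibrium $P$ is semi-stable if there are open sets $U_1,U_2\subset\{|s|<1\}$, both having $P$ in their boundary, such that (i) for every $\varepsilon>0$ there is $\delta>0$ such that every trajectory starting in $U_1$ within distance $\delta$ of $P$ stays within $\varepsilon$ of $P$ for all $n>0$, and (ii) for some $\varepsilon_0>0$ every trajectory starting in $U_2$ leaves the $\varepsilon_0$-neighbourhood of $P$ after finitely many iterations. Then: (a) If $\lambda\ge0$,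 $\beta\ge1$, then $E$ and $F$ are semi-stable and all other equilibrium points are unstable. Each trajectory starting at a non-equilibrium point converges to $E$ or to $F$. (b) If $|\beta|<1$, then all equilibrium points are stable and each trajectory converges to an equilibrium point. (c) If $\lambda\ge0$, $\beta<-1$, then $E$ and $F$ are semi-stable when $\lambda>0$ and unstable when $\lambda=0$; all other equilibrium points are unstable; and $\{Q,-Q\}$ is a stable $2$-periodic orbit. Each trajectory starting at a non-equilibrium point converges to $E$, to $F$, or to the orbit $\pm Q$. (d) If $\lambda<0$, $\beta<-1$, then all equilibrium points are unstable, and each trajectory starting at a non-equilibrium point converges to the stable $2$-periodic orbit $\pm Q$. (e) If $\lambda<0$, $\beta>1$, then all equilibrium points are unstable, and there are periodic orbits of all sufficiently large (minimal) periods. If moreover there is no $k\in\mathbb N$ with $\frac{\beta^k-1}{\beta-1}=-\frac1\lambda<\beta^k$, then at most one periodic orbit is stable. (f) If $\lambda<0$, $\beta=1$, then all equilibrium points are unstable. Each trajectory either reaches $E$ or $F$ after finitely many steps, or converges to the segment $EF$ (its distance to $EF$ tends to $0$). (g) If $\beta=-1$, then all equilibrium points are stable and $Q=(1,1)$. The set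 $$\Sigma=\{(x,s):\ 2(1-\lambda)(x-1)\le(1-\lambda+a)(s-1)\le 2\big((1-\lambda)x-a\big),\ |s|\le1\}$$ is the parallelogram with vertices $E,Q,F,-Q$; it contains the segment $EF$ of equilibrium points, and each of its other points lies on a stable $2$-periodic orbit contained in $\Sigma$. Each trajectory starting at a non-equilibrium point converges to $E$, to $F$, or to a $2$-periodic orbit contained in $\Sigma$. -/

import Mathlib

open Set Filter Topology

noncomputable section

namespace StopMap

/-- The saturation `Φ`: `-1` for `τ < -1`, `τ` for `|τ| ≤ 1`, `1` for `τ > 1`. -/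
def Phi (τ : ℝ) : ℝ := if τ < -1 then -1 else if τ ≤ 1 then τ else 1

/-- The planar map `(x, s) ↦ (x', s')` with `x' = lam * x + a * s`, `s' = Φ (s + x' - x)`. -/
def step (lam a : ℝ) (z : ℝ × ℝ) : ℝ × ℝ :=
  (lam * z.1 + a * z.2, Phi (z.2 + (lam * z.1 + a * z.2) - z.1))

/-- The state at time `n` of the trajectory starting at `z`. -/
def traj (lam a : ℝ) (z : ℝ × ℝ) (n : ℕ) : ℝ × ℝ := (step lam a)^[n] z

/-- The phase space: the strip `|s| ≤ 1`. -/
def strip : Set (ℝ × ℝ) := {z | |z.2| ≤ 1}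

/-- The upper end point `E` of the segment of equilibria. -/
def ptE (lam a : ℝ) : ℝ × ℝ := (a / (1 - lam), 1)

/-- The lower end point `F` of the segment of equilibria. -/
def ptF (lam a : ℝ) : ℝ × ℝ := (-(a / (1 - lam)), -1)

/-- The segment `EF`. -/
def segEF (lam a : ℝ) : Set (ℝ × ℝ) :=
  {z | z.1 = a * z.2 / (1 - lam) ∧ -1 ≤ z.2 ∧ z.2 ≤ 1}

/-- The point `Q`; the candidate `2`-periodic orbit is `{Q, -Q}`. -/
def ptQ (lam a : ℝ) : ℝ × ℝ := (-(a / (1 + lam)), 1)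

/-- Equilibrium points of the system: fixed points of the map in the strip. -/
def IsEquilibrium (lam a : ℝ) (z : ℝ × ℝ) : Prop :=
  z ∈ strip ∧ step lam a z = z

/-- `z` is a point of a periodic orbit in the strip whose (minimal) period is `n ≥ 1`. -/
def HasPeriod (lam a : ℝ) (n : ℕ) (z : ℝ × ℝ) : Prop :=
  z ∈ strip ∧ 0 < n ∧ Function.minimalPeriod (step lam a) z = n

/-- Lyapunov stability (within the strip) of the trajectory of `z`. For an equilibrium this is
Lyapunov stability of the equilibrium; for a periodic point it is Lyapunov stability of the
periodic orbit (the map is continuous, so the choice of the point of the orbit is immaterial). -/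
def IsStable (lam a : ℝ) (z : ℝ × ℝ) : Prop :=
  ∀ ε > 0, ∃ δ > 0, ∀ w ∈ strip, dist w z < δ →
    ∀ n : ℕ, dist (traj lam a w n) (traj lam a z n) < ε

/-- Semi-stability of an equilibrium `z`. -/
def IsSemiStable (lam a : ℝ) (z : ℝ × ℝ) : Prop :=
  IsEquilibrium lam a z ∧
  ∃ U₁ U₂ : Set (ℝ × ℝ), IsOpen U₁ ∧ IsOpen U₂ ∧
    U₁ ⊆ {w | |w.2| < 1} ∧ U₂ ⊆ {w | |w.2| < 1} ∧
    z ∈ frontier U₁ ∧ z ∈ frontier U₂ ∧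
    (∀ ε > 0, ∃ δ > 0, ∀ w ∈ U₁, dist w z < δ →
      ∀ n : ℕ, 0 < n → dist (traj lam a w n) z < ε) ∧
    (∃ ε₀ > 0, ∀ w ∈ U₂, ∃ n : ℕ, ε₀ ≤ dist (traj lam a w n) z)

/-- The trajectory of `z` converges to the point `q`. -/
def ConvergesTo (lam a : ℝ) (z q : ℝ × ℝ) : Prop :=
  Tendsto (traj lam a z) atTop (𝓝 q)

/-- The trajectory of `z` converges to the orbit of `q` (with a fixed phase `k`). -/
def ConvergesToOrbit (lam a : ℝ) (z q : ℝ × ℝ) : Prop :=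
  ∃ k : ℕ, Tendsto (fun n => dist (traj lam a z n) (traj lam a q (n + k))) atTop (𝓝 0)

/-- The parallelogram `Σ`, with the inequalities for `s - 1` multiplied by `1 - lam + a`
so that the description is meaningful for every sign of that number. -/
def parSigma (lam a : ℝ) : Set (ℝ × ℝ) :=
  {z | 2 * ((1 - lam) * (z.1 - 1)) ≤ (1 - lam + a) * (z.2 - 1) ∧
       (1 - lam + a) * (z.2 - 1) ≤ 2 * ((1 - lam) * z.1 - a) ∧ |z.2| ≤ 1}

/-- `±Q` is a `2`-periodic orbit (of minimal period `2`) in the strip, and it is stable. -/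
def StableTwoOrbitQ (lam a : ℝ) : Prop :=
  HasPeriod lam a 2 (ptQ lam a) ∧ step lam a (ptQ lam a) = -ptQ lam a ∧
    IsStable lam a (ptQ lam a) ∧ IsStable lam a (-ptQ lam a)

end StopMap

end

namespace StopMap

variable {lam a : ℝ}

/-! ### The saturation -/

/-! Replace `x` by the velocity `d`, the increment of `x` in one step. The map becomes `(s, d) ↦
(s', lam * d + a * (s' - s))` with `s' = Phi (s + d)`. Equilibria are the points of the strip with
`d = 0`. An unsaturated step multiplies `d` by `β = lam + a`; since saturation keeps a fraction of
the increment of `s`, every step multiplies `d` by a convex combination of `lam` and `β`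
(`exists_step_factor`). The map is odd, so only one end of the segment needs study.

If `|β| < 1`, the velocity decays geometrically and the positions converge. If `β ≥ 1`, every moving
point saturates (`exists_saturating`). For `lam ≥ 0` it keeps its direction and slides along the
boundary to `E` or `F`; for `lam < 0`, `β = 1`, each saturation soon shrinks the velocity by the
factor `|lam|` (`exists_abs_vel_le`).

If `β = -1`, use `s` and `t = s + d`. The map is `(s, t) ↦ (Phi t, s + lam * (t - Phi t))`, a swap
of coordinates up to the overshoot `t - Phi t`. It is nonexpansive in the `ℓ¹` norm, and that norm
pays for the overshoots, so they are summable (`summable_overshoot`) and the even and odd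
subsequences converge.

If `β < -1`, unsaturated motion oscillates with growing amplitude until it saturates. It then either
slides outward to an end point, possible only for `lam ≥ 0`, or turns inward and eventually jumps
between `s = ±1` forever (`exists_traj_jump`). On jumps the velocity follows, up to sign, the
contraction `D ↦ -2a - lam * D`, whose fixed point is the orbit of `±Q`.

If `lam = -l < 0` and `β = b > 1`, follow the velocity `D` at successive departures from `s = ±1`,
up to sign. The return map `ret` is piecewise affine with tent-like peaks at `D = 2 / geo b k`.
Cycles with two long climbs give all large periods. For stability choose `K` with `l * geo b K ≤ 1 <
l * geo b (K + 1)`. Every cycle lies below the `K`-th peak value. Below the `K`-th breakpoint the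
map expands; between breakpoint and peak value, when that interval is nonempty, it is an affine
contraction except in the resonant case `l * geo b K = 1`, which the hypothesis rules out. So a
stable cycle must contain the single point `attr` (`cycle_dichotomy`, `not_isStable_of_expanding`).
-/

lemma Phi_eq_max (τ : ℝ) : Phi τ = max (-1) (min τ 1) := by
  unfold Phi
  split_ifs with h1 h2
  · rw [max_eq_left ((min_le_left _ _).trans h1.le)]
  · rw [min_eq_left h2, max_eq_right (not_lt.mp h1)]
  · rw [min_eq_right (not_le.mp h2).le, max_eq_right (by norm_num)]

lemma continuous_Phi : Continuous Phi := by
  have : Phi = fun τ => max (-1) (min τ 1) := funext Phi_eq_max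
  rw [this]; fun_prop

lemma Phi_of_mem {τ : ℝ} (h1 : -1 ≤ τ) (h2 : τ ≤ 1) : Phi τ = τ := by
  simp [Phi, not_lt.mpr h1, h2]

lemma Phi_of_one_le {τ : ℝ} (h : 1 ≤ τ) : Phi τ = 1 := by
  rw [Phi_eq_max, min_eq_right h, max_eq_right (by norm_num)]

lemma Phi_of_le_neg_one {τ : ℝ} (h : τ ≤ -1) : Phi τ = -1 := by
  rw [Phi_eq_max, max_eq_left ((min_le_left _ _).trans h)]

lemma Phi_neg (τ : ℝ) : Phi (-τ) = -Phi τ := by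
  rcases le_total τ (-1) with h | h
  · rw [Phi_of_le_neg_one h, Phi_of_one_le (by linarith)]; norm_num
  rcases le_total τ 1 with h' | h'
  · rw [Phi_of_mem h h', Phi_of_mem (by linarith) (by linarith)]
  · rw [Phi_of_one_le h', Phi_of_le_neg_one (by linarith)]

lemma abs_Phi_le (τ : ℝ) : |Phi τ| ≤ 1 := by
  rw [abs_le, Phi_eq_max]
  exact ⟨le_max_left _ _, max_le (by norm_num) (min_le_right _ _)⟩

/-- The increment of a saturated step is a fraction of the unsaturated increment. -/
lemma exists_Phi_sub (s d : ℝ) (hs : |s| ≤ 1) :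
    ∃ θ : ℝ, 0 ≤ θ ∧ θ ≤ 1 ∧ Phi (s + d) - s = θ * d := by
  obtain ⟨h1, h2⟩ := abs_le.mp hs
  rcases le_total (s + d) (-1) with h | h
  · rw [Phi_of_le_neg_one h]
    rcases eq_or_ne d 0 with rfl | hd
    · exact ⟨0, le_rfl, zero_le_one, by linarith⟩
    have hd' : d < 0 := lt_of_le_of_ne (by linarith) hd
    exact ⟨(-1 - s) / d, div_nonneg_of_nonpos (by linarith) hd'.le,
      (div_le_one_of_neg hd').mpr (by linarith), by field_simp⟩
  rcases le_total (s + d) 1 with h' | h'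
  · exact ⟨1, zero_le_one, le_rfl, by rw [Phi_of_mem h h']; ring⟩
  · rw [Phi_of_one_le h']
    rcases eq_or_ne d 0 with rfl | hd
    · exact ⟨0, le_rfl, zero_le_one, by linarith⟩
    have hd' : 0 < d := lt_of_le_of_ne (by linarith) hd.symm
    exact ⟨(1 - s) / d, div_nonneg (by linarith) hd'.le,
      (div_le_one hd').mpr (by linarith), by field_simp⟩

/-! ### Coordinates: position `s` and velocity `d` of `x` -/

/-- The increment of `x` in one step. -/
def vel (lam a : ℝ) (z : ℝ × ℝ) : ℝ := (lam - 1) * z.1 + a * z.2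

/-- The point with second coordinate `s` and velocity `d`. -/
noncomputable def pt (lam a s d : ℝ) : ℝ × ℝ := ((a * s - d) / (1 - lam), s)

@[simp] lemma pt_snd (s d : ℝ) : (pt lam a s d).2 = s := rfl

lemma one_sub_pos (h : |lam| < 1) : 0 < 1 - lam := by linarith [(abs_lt.mp h).2]

lemma one_add_pos (h : |lam| < 1) : 0 < 1 + lam := by linarith [(abs_lt.mp h).1]

lemma vel_pt (h : |lam| < 1) (s d : ℝ) : vel lam a (pt lam a s d) = d := by
  have := (one_sub_pos h).ne'
  simp only [vel, pt]; field_simp; ring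

lemma pt_eta (h : |lam| < 1) (z : ℝ × ℝ) : pt lam a z.2 (vel lam a z) = z := by
  have := (one_sub_pos h).ne'
  refine Prod.ext ?_ rfl
  simp only [vel, pt]; field_simp; ring

lemma pt_injective (h : |lam| < 1) {s d s' d' : ℝ} (e : pt lam a s d = pt lam a s' d') :
    s = s' ∧ d = d' :=
  ⟨congrArg Prod.snd e, by simpa [vel_pt h] using congrArg (vel lam a) e⟩

lemma step_pt (h : |lam| < 1) (s d : ℝ) : step lam a (pt lam a s d) =
    pt lam a (Phi (s + d)) (lam * d + a * (Phi (s + d) - s)) := by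
  have h0 := (one_sub_pos h).ne'
  have e : s + (lam * ((a * s - d) / (1 - lam)) + a * s) - (a * s - d) / (1 - lam) = s + d := by
    field_simp; ring
  simp only [step, pt]
  rw [e]
  refine Prod.ext ?_ rfl
  simp only; field_simp; ring

lemma step_pt_unsat (h : |lam| < 1) {s d : ℝ} (h1 : -1 ≤ s + d) (h2 : s + d ≤ 1) :
    step lam a (pt lam a s d) = pt lam a (s + d) ((lam + a) * d) := by
  rw [step_pt h, Phi_of_mem h1 h2]; congr 1; ring

lemma step_pt_top (h : |lam| < 1) {s d : ℝ} (h1 : 1 ≤ s + d) :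
    step lam a (pt lam a s d) = pt lam a 1 (lam * d + a * (1 - s)) := by
  rw [step_pt h, Phi_of_one_le h1]

lemma neg_pt (s d : ℝ) : -pt lam a s d = pt lam a (-s) (-d) := by
  refine Prod.ext ?_ rfl
  simp only [pt, Prod.neg_mk]; ring

lemma step_neg (z : ℝ × ℝ) : step lam a (-z) = -step lam a z := by
  refine Prod.ext ?_ ?_
  · simp only [step, Prod.fst_neg, Prod.snd_neg]; ring
  · simp only [step, Prod.fst_neg, Prod.snd_neg]
    rw [← Phi_neg]; congr 1; ring

/-! ### Iteration and central symmetry. -/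

lemma traj_zero (z : ℝ × ℝ) : traj lam a z 0 = z := rfl

lemma traj_succ (z : ℝ × ℝ) (n : ℕ) : traj lam a z (n + 1) = step lam a (traj lam a z n) :=
  Function.iterate_succ_apply' _ _ _

lemma traj_succ' (z : ℝ × ℝ) (n : ℕ) : traj lam a z (n + 1) = traj lam a (step lam a z) n :=
  Function.iterate_succ_apply _ _ _

lemma traj_add (z : ℝ × ℝ) (m n : ℕ) :
    traj lam a z (m + n) = traj lam a (traj lam a z m) n := by
  simp only [traj]; rw [add_comm, Function.iterate_add_apply]

lemma traj_neg (z : ℝ × ℝ) (n : ℕ) : traj lam a (-z) n = -traj lam a z n := by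
  induction n with
  | zero => rfl
  | succ n ih => rw [traj_succ, traj_succ, ih, step_neg]

lemma continuous_step : Continuous (step lam a) := by
  have := continuous_Phi
  unfold step; fun_prop

lemma continuous_vel : Continuous (vel lam a) := by
  unfold vel; fun_prop

lemma continuous_pt (lam a : ℝ) : Continuous (fun p : ℝ × ℝ => pt lam a p.1 p.2) := by
  unfold pt; simp only [div_eq_mul_inv]; fun_prop

lemma tendsto_pt {α : Type*} {l : Filter α} {u v : α → ℝ} {s d : ℝ} (hu : Tendsto u l (𝓝 s))
    (hv : Tendsto v l (𝓝 d)) : Tendsto (fun n => pt lam a (u n) (v n)) l (𝓝 (pt lam a s d)) :=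
  ((continuous_pt lam a).tendsto (s, d)).comp (hu.prodMk_nhds hv)

lemma step_mem_strip (z : ℝ × ℝ) : step lam a z ∈ strip := abs_Phi_le _

lemma traj_mem_strip {z : ℝ × ℝ} (hz : z ∈ strip) (n : ℕ) : traj lam a z n ∈ strip := by
  cases n with
  | zero => exact hz
  | succ n => rw [traj_succ]; exact step_mem_strip _

lemma pt_mem_strip {s d : ℝ} : pt lam a s d ∈ strip ↔ |s| ≤ 1 := Iff.rfl

lemma neg_mem_strip {z : ℝ × ℝ} : -z ∈ strip ↔ z ∈ strip := by
  simp [strip]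

lemma snd_step (h : |lam| < 1) (z : ℝ × ℝ) :
    (step lam a z).2 = Phi (z.2 + vel lam a z) := by
  conv_lhs => rw [← pt_eta h (a := a) z, step_pt h]
  rfl

lemma vel_step (h : |lam| < 1) (z : ℝ × ℝ) : vel lam a (step lam a z) =
    lam * vel lam a z + a * ((step lam a z).2 - z.2) := by
  rw [snd_step h]
  conv_lhs => rw [← pt_eta h (a := a) z, step_pt h, vel_pt h]

/-- Saturation only shortens the increment of `s`, to `θ * d`; substituting this into `d' = lam * d
+ a * (s' - s)` gives a multiplier between `lam` and `lam + a`. -/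
lemma exists_step_factor (h : |lam| < 1) {z : ℝ × ℝ} (hz : z ∈ strip) :
    ∃ θ : ℝ, 0 ≤ θ ∧ θ ≤ 1 ∧ (step lam a z).2 - z.2 = θ * vel lam a z ∧
      vel lam a (step lam a z) = ((1 - θ) * lam + θ * (lam + a)) * vel lam a z := by
  obtain ⟨θ, h0, h1, e⟩ := exists_Phi_sub z.2 (vel lam a z) hz
  refine ⟨θ, h0, h1, by rw [snd_step h, e], ?_⟩
  rw [vel_step h, snd_step h, e]; ring

/-! ### Equilibria and the distinguished points in position and velocity coordinates. -/

lemma isEquilibrium_iff (h : |lam| < 1) {z : ℝ × ℝ} :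
    IsEquilibrium lam a z ↔ z ∈ strip ∧ vel lam a z = 0 := by
  refine and_congr_right fun hz => ⟨fun e => ?_, fun e => ?_⟩
  · have := congrArg Prod.fst e
    simp only [step] at this
    simp only [vel]; linarith
  · obtain ⟨h1, h2⟩ := abs_le.mp (show |z.2| ≤ 1 from hz)
    rw [← pt_eta h (a := a) z, e, step_pt_unsat h (by linarith) (by linarith)]; simp

lemma isEquilibrium_pt (h : |lam| < 1) {s d : ℝ} :
    IsEquilibrium lam a (pt lam a s d) ↔ |s| ≤ 1 ∧ d = 0 := by
  rw [isEquilibrium_iff h, vel_pt h, pt_mem_strip]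

lemma IsEquilibrium.traj_eq {z : ℝ × ℝ} (hz : IsEquilibrium lam a z) (n : ℕ) :
    traj lam a z n = z := Function.iterate_fixed hz.2 n

lemma IsEquilibrium.eq_pt (h : |lam| < 1) {z : ℝ × ℝ} (hz : IsEquilibrium lam a z) :
    z = pt lam a z.2 0 := by
  rw [← ((isEquilibrium_iff h).mp hz).2, pt_eta h]

lemma ptE_eq : ptE lam a = pt lam a 1 0 := by simp [ptE, pt]

lemma ptF_eq : ptF lam a = -pt lam a 1 0 := by rw [← ptE_eq]; simp [ptE, ptF]

lemma ptQ_eq (h : |lam| < 1) : ptQ lam a = pt lam a 1 (2 * a / (1 + lam)) := by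
  have h1 := (one_sub_pos h).ne'
  have h2 := (one_add_pos h).ne'
  refine Prod.ext ?_ rfl
  simp only [ptQ, pt]; field_simp; ring

lemma isEquilibrium_neg {z : ℝ × ℝ} : IsEquilibrium lam a (-z) ↔ IsEquilibrium lam a z := by
  unfold IsEquilibrium; rw [neg_mem_strip, step_neg, neg_inj]

lemma isEquilibrium_ptE (h : |lam| < 1) : IsEquilibrium lam a (ptE lam a) := by
  rw [ptE_eq, isEquilibrium_pt h]; simp

/-- Symmetry: neighbourhoods and trajectories of `-z` mirror those of `z`. -/
lemma IsStable.neg {z : ℝ × ℝ} (hz : IsStable lam a z) : IsStable lam a (-z) := by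
  intro ε hε
  obtain ⟨δ, hδ, H⟩ := hz ε hε
  refine ⟨δ, hδ, fun w hw hd n => ?_⟩
  have := H (-w) (neg_mem_strip.mpr hw) (by rwa [← dist_neg_neg, neg_neg]) n
  rwa [traj_neg, ← dist_neg_neg, neg_neg, ← traj_neg] at this

lemma IsSemiStable.neg {z : ℝ × ℝ} (hz : IsSemiStable lam a z) : IsSemiStable lam a (-z) := by
  obtain ⟨heq, U₁, U₂, ho1, ho2, hs1, hs2, hf1, hf2, H1, ε₀, hε₀, H2⟩ := hz
  have hfr : ∀ U : Set (ℝ × ℝ), z ∈ frontier U → -z ∈ frontier (-U) := by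
    intro U hU
    have := (Homeomorph.neg (ℝ × ℝ)).preimage_frontier U
    change -frontier U = frontier (-U) at this
    rw [← this]; simpa using hU
  refine ⟨isEquilibrium_neg.mpr heq, -U₁, -U₂, ho1.neg, ho2.neg, ?_, ?_, hfr _ hf1, hfr _ hf2,
    ?_, ε₀, hε₀, ?_⟩
  · intro w hw; have := hs1 hw; simpa using this
  · intro w hw; have := hs2 hw; simpa using this
  · intro ε hε
    obtain ⟨δ, hδ, H⟩ := H1 ε hε
    refine ⟨δ, hδ, fun w hw hd n hn => ?_⟩
    have := H (-w) hw (by rwa [← dist_neg_neg, neg_neg]) n hn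
    rwa [traj_neg, ← dist_neg_neg, neg_neg] at this
  · intro w hw
    obtain ⟨n, hn⟩ := H2 (-w) hw
    refine ⟨n, ?_⟩
    rwa [traj_neg, ← dist_neg_neg, neg_neg] at hn

lemma ConvergesTo.neg {z q : ℝ × ℝ} (hz : ConvergesTo lam a z q) :
    ConvergesTo lam a (-z) (-q) := by
  have : traj lam a (-z) = fun n => -traj lam a z n := funext (traj_neg z)
  unfold ConvergesTo; rw [this]; exact Filter.Tendsto.neg hz

lemma convergesTo_of_traj {z q : ℝ × ℝ} (m : ℕ) (hz : ConvergesTo lam a (traj lam a z m) q) :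
    ConvergesTo lam a z q := by
  refine (tendsto_add_atTop_iff_nat m).mp ?_
  refine Filter.Tendsto.congr (fun n => ?_) hz
  rw [← traj_add, add_comm]

/-! ### Metric comparison -/

lemma abs_snd_sub_le (z w : ℝ × ℝ) : |z.2 - w.2| ≤ dist z w := by
  rw [← Real.dist_eq, Prod.dist_eq]; exact le_max_right _ _

lemma abs_vel_sub_le (h : |lam| < 1) (z w : ℝ × ℝ) :
    |vel lam a z - vel lam a w| ≤ (2 + |a|) * dist z w := by
  have h1 : |z.1 - w.1| ≤ dist z w := by
    rw [← Real.dist_eq, Prod.dist_eq]; exact le_max_left _ _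
  have h2 := abs_snd_sub_le z w
  have e : vel lam a z - vel lam a w = (lam - 1) * (z.1 - w.1) + a * (z.2 - w.2) := by
    simp only [vel]; ring
  have h3 : |lam - 1| ≤ 2 := by
    obtain ⟨h4, h5⟩ := abs_lt.mp h
    rw [abs_le]; constructor <;> linarith
  calc _ ≤ |lam - 1| * |z.1 - w.1| + |a| * |z.2 - w.2| := by
        rw [e, ← abs_mul, ← abs_mul]; exact abs_add_le _ _
    _ ≤ 2 * dist z w + |a| * dist z w := by gcongr
    _ = _ := by ring

/-- Inverting the velocity, `x = (a * s - d) / (1 - lam)`, so closeness in position and velocity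
controls the product metric. -/
lemma dist_le_coords (h : |lam| < 1) (z w : ℝ × ℝ) :
    dist z w ≤ ((|a| + 1) / (1 - lam) + 1) * (|z.2 - w.2| + |vel lam a z - vel lam a w|) := by
  have h0 := one_sub_pos h
  have e : z.1 - w.1 = (a * (z.2 - w.2) - (vel lam a z - vel lam a w)) / (1 - lam) := by
    rw [eq_div_iff h0.ne']; simp only [vel]; ring
  have hA := abs_nonneg (z.2 - w.2)
  have hB := abs_nonneg (vel lam a z - vel lam a w)
  have hC := abs_nonneg a
  rw [Prod.dist_eq, Real.dist_eq, Real.dist_eq]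
  refine max_le ?_ ?_
  · calc |z.1 - w.1| ≤ (|a| * |z.2 - w.2| + |vel lam a z - vel lam a w|) / (1 - lam) := by
          rw [e, abs_div, abs_of_pos h0, ← abs_mul]; gcongr; exact abs_sub _ _
      _ ≤ ((|a| + 1) * (|z.2 - w.2| + |vel lam a z - vel lam a w|)) / (1 - lam) := by
          gcongr; nlinarith
      _ = (|a| + 1) / (1 - lam) * (|z.2 - w.2| + |vel lam a z - vel lam a w|) := by ring
      _ ≤ _ := by gcongr; linarith
  · have : 0 ≤ (|a| + 1) / (1 - lam) := by positivity
    nlinarith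

/-- A linear bound on the divergence of trajectories, in the coordinates position and velocity,
gives stability. -/
lemma isStable_of_linear_bound (h : |lam| < 1) {z : ℝ × ℝ} {C r : ℝ} (hr : 0 < r)
    (H : ∀ w ∈ strip, |w.2 - z.2| + |vel lam a w - vel lam a z| < r → ∀ n,
      |(traj lam a w n).2 - (traj lam a z n).2| +
        |vel lam a (traj lam a w n) - vel lam a (traj lam a z n)| ≤
      C * (|w.2 - z.2| + |vel lam a w - vel lam a z|)) : IsStable lam a z := by
  intro ε hε
  have h0 := one_sub_pos h
  set A : ℝ := (|a| + 1) / (1 - lam) + 1 with hA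
  have hApos : 0 < A := by positivity
  set B : ℝ := 3 + |a| with hB
  have hBpos : 0 < B := by positivity
  have hC : 0 < |C| + 1 := by positivity
  refine ⟨min (r / B) (ε / (A * (|C| + 1) * B)), by positivity, fun w hw hd n => ?_⟩
  have hL : |w.2 - z.2| + |vel lam a w - vel lam a z| ≤ B * dist w z := by
    have := abs_snd_sub_le w z
    have := abs_vel_sub_le (a := a) h w z
    rw [hB]; linarith
  have hd1 : B * dist w z < r := by
    have := lt_of_lt_of_le hd (min_le_left _ _)
    rw [lt_div_iff₀ hBpos] at this; linarith
  have hd2 : dist w z * (A * (|C| + 1) * B) < ε := by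
    have := lt_of_lt_of_le hd (min_le_right _ _)
    rwa [lt_div_iff₀ (by positivity)] at this
  refine (dist_le_coords (a := a) h _ _).trans_lt ?_
  have hnn : 0 ≤ |w.2 - z.2| + |vel lam a w - vel lam a z| := by positivity
  have H' := H w hw (hL.trans_lt hd1) n
  calc _ ≤ A * (C * (|w.2 - z.2| + |vel lam a w - vel lam a z|)) := by
        exact mul_le_mul_of_nonneg_left H' hApos.le
    _ ≤ A * ((|C| + 1) * (B * dist w z)) := by
        refine mul_le_mul_of_nonneg_left ?_ hApos.le
        calc _ ≤ (|C| + 1) * (|w.2 - z.2| + |vel lam a w - vel lam a z|) := by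
              refine mul_le_mul_of_nonneg_right ?_ hnn
              linarith [le_abs_self C]
          _ ≤ _ := by gcongr
    _ = dist w z * (A * (|C| + 1) * B) := by ring
    _ < ε := hd2

/-- An equilibrium is unstable if trajectories from arbitrarily near leave a fixed ball. -/
lemma not_isStable_of_escape {z : ℝ × ℝ} (hz : IsEquilibrium lam a z) {ε : ℝ} (hε : 0 < ε)
    (H : ∀ δ > 0, ∃ w ∈ strip, dist w z < δ ∧ ∃ n, ε ≤ dist (traj lam a w n) z) :
    ¬ IsStable lam a z := by
  intro hs
  obtain ⟨δ, hδ, hw⟩ := hs ε hε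
  obtain ⟨w, hw1, hw2, n, hn⟩ := H δ hδ
  have := hw w hw1 hw2 n
  rw [hz.traj_eq] at this
  linarith

lemma exists_dist_pt_lt (s₀ : ℝ) {δ : ℝ} (hδ : 0 < δ) :
    ∃ η > 0, ∀ s d, |s - s₀| < η → |d| < η → dist (pt lam a s d) (pt lam a s₀ 0) < δ := by
  have hc := (continuous_pt lam a).tendsto (s₀, 0)
  obtain ⟨η, hη, H⟩ := Metric.tendsto_nhds_nhds.mp hc δ hδ
  refine ⟨η, hη, fun s d hs hd => H (x := (s, d)) ?_⟩
  rw [Prod.dist_eq, Real.dist_eq, Real.dist_eq]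
  exact max_lt hs (by simpa using hd)

lemma tendsto_of_even_of_odd {α : Type*} {f : ℕ → α} {l : Filter α}
    (h0 : Tendsto (fun n => f (2 * n)) atTop l) (h1 : Tendsto (fun n => f (2 * n + 1)) atTop l) :
    Tendsto f atTop l := by
  intro U hU
  obtain ⟨N0, H0⟩ := mem_atTop_sets.mp (h0 hU)
  obtain ⟨N1, H1⟩ := mem_atTop_sets.mp (h1 hU)
  refine mem_atTop_sets.mpr ⟨2 * (N0 + N1) + 1, fun n hn => ?_⟩
  obtain ⟨k, rfl | rfl⟩ := Nat.even_or_odd' n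
  · exact H0 k (by omega)
  · exact H1 k (by omega)

lemma HasPeriod.of_two {z : ℝ × ℝ} (hz : z ∈ strip) (h2 : step lam a (step lam a z) = z)
    (h1 : step lam a z ≠ z) : HasPeriod lam a 2 z :=
  ⟨hz, two_pos, Function.minimalPeriod_eq_prime (f := step lam a) (p := 2) h2 h1⟩

/-! ### Contraction of the velocity: `|lam + a| < 1` -/

/-- The multiplier of each step is a convex combination of two numbers of modulus at most `q`. The
choice `q = 1` serves later for `lam + a = 1`. -/
lemma abs_vel_traj_le (h : |lam| < 1) {q : ℝ} (hl : |lam| ≤ q) (hb : |lam + a| ≤ q)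
    {z : ℝ × ℝ} (hz : z ∈ strip) (n : ℕ) :
    |vel lam a (traj lam a z n)| ≤ |vel lam a z| * q ^ n := by
  have hq : 0 ≤ q := (abs_nonneg _).trans hl
  induction n with
  | zero => simp [traj_zero]
  | succ n ih =>
    obtain ⟨θ, h0, h1, -, e⟩ := exists_step_factor (a := a) h (traj_mem_strip (a := a) hz n)
    rw [traj_succ, e, abs_mul]
    have : |(1 - θ) * lam + θ * (lam + a)| ≤ q := by
      calc _ ≤ |(1 - θ) * lam| + |θ * (lam + a)| := abs_add_le _ _
        _ = (1 - θ) * |lam| + θ * |lam + a| := by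
            rw [abs_mul, abs_mul, abs_of_nonneg (sub_nonneg.mpr h1), abs_of_nonneg h0]
        _ ≤ (1 - θ) * q + θ * q := by
            have := sub_nonneg.mpr h1
            gcongr
        _ = q := by ring
    calc _ ≤ q * (|vel lam a z| * q ^ n) := by gcongr
      _ = _ := by ring

lemma abs_snd_step_sub_le (h : |lam| < 1) {z : ℝ × ℝ} (hz : z ∈ strip) :
    |(step lam a z).2 - z.2| ≤ |vel lam a z| := by
  obtain ⟨θ, h0, h1, e, -⟩ := exists_step_factor (a := a) h hz
  rw [e, abs_mul, abs_of_nonneg h0]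
  nlinarith [abs_nonneg (vel lam a z)]

lemma isStable_and_converges_of_abs_lt_one (h : |lam| < 1) (hb : |lam + a| < 1) :
    (∀ z, IsEquilibrium lam a z → IsStable lam a z) ∧
    (∀ z ∈ strip, ∃ q, IsEquilibrium lam a q ∧ ConvergesTo lam a z q) := by
  set q : ℝ := max |lam| |lam + a| with hq
  have hq0 : 0 ≤ q := (abs_nonneg _).trans (le_max_left _ _)
  have hq1 : q < 1 := max_lt h hb
  have hv : ∀ z ∈ strip, ∀ n, |vel lam a (traj lam a z n)| ≤ |vel lam a z| * q ^ n :=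
    fun z hz n => abs_vel_traj_le h (le_max_left _ _) (le_max_right _ _) hz n
  have hstep : ∀ z ∈ strip, ∀ n,
      dist (traj lam a z n).2 (traj lam a z (n + 1)).2 ≤ |vel lam a z| * q ^ n := by
    intro z hz n
    rw [dist_comm, Real.dist_eq, traj_succ]
    exact (abs_snd_step_sub_le h (traj_mem_strip hz n)).trans (hv z hz n)
  constructor
  · intro z hz
    -- The summed increments of `s` contribute at most `1 / (1 - q)` times the initial velocity, and
    -- the current velocity at most once that velocity.
    refine isStable_of_linear_bound h (C := 2 + 1 / (1 - q)) one_pos fun w hw _ n => ?_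
    have hz0 := ((isEquilibrium_iff h).mp hz).2
    rw [hz.traj_eq, hz0, sub_zero, sub_zero]
    have h1 := dist_le_range_sum_of_dist_le (f := fun n => (traj lam a w n).2) n
      (fun {k} _ => hstep w hw k)
    have hsum : ∑ i ∈ Finset.range n, |vel lam a w| * q ^ i ≤ |vel lam a w| * (1 / (1 - q)) := by
      rw [← Finset.mul_sum, one_div, ← tsum_geometric_of_lt_one hq0 hq1]
      exact mul_le_mul_of_nonneg_left ((summable_geometric_of_lt_one hq0 hq1).sum_le_tsum _
        (fun i _ => pow_nonneg hq0 i)) (abs_nonneg _)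
    have h2 : |vel lam a (traj lam a w n)| ≤ |vel lam a w| := by
      refine (hv w hw n).trans (mul_le_of_le_one_right (abs_nonneg _) (pow_le_one₀ hq0 hq1.le))
    have h3 : |(traj lam a w n).2 - z.2| ≤
        |(traj lam a w n).2 - w.2| + |w.2 - z.2| := abs_sub_le _ _ _
    rw [Real.dist_eq, traj_zero, abs_sub_comm] at h1
    have h4 : 0 ≤ 1 / (1 - q) := by
      have := sub_pos.mpr hq1
      positivity
    have h5 := mul_nonneg h4 (abs_nonneg (w.2 - z.2))
    have := abs_nonneg (w.2 - z.2)
    have := abs_nonneg (vel lam a w)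
    nlinarith
  · intro z hz
    obtain ⟨s, hs⟩ := cauchySeq_tendsto_of_complete
      (cauchySeq_of_le_geometric q |vel lam a z| hq1 (hstep z hz))
    have hd : Tendsto (fun n => vel lam a (traj lam a z n)) atTop (𝓝 0) := by
      refine squeeze_zero_norm (hv z hz) ?_
      simpa using (tendsto_pow_atTop_nhds_zero_of_lt_one hq0 hq1).const_mul |vel lam a z|
    refine ⟨pt lam a s 0, (isEquilibrium_pt h).mpr ⟨?_, rfl⟩, ?_⟩
    · exact le_of_tendsto hs.abs (Eventually.of_forall fun n => traj_mem_strip hz n)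
    · exact (tendsto_pt hs hd).congr fun n => pt_eta h _

/-! ### The nonexpansive case `lam + a = -1` -/

lemma exists_Phi_sub_Phi (t u : ℝ) :
    ∃ θ : ℝ, 0 ≤ θ ∧ θ ≤ 1 ∧ Phi t - Phi u = θ * (t - u) := by
  wlog hut : u < t generalizing t u
  · rcases (not_lt.mp hut).eq_or_lt with rfl | h
    · exact ⟨0, le_rfl, zero_le_one, by simp⟩
    · obtain ⟨θ, h0, h1, e⟩ := this u t h
      exact ⟨θ, h0, h1, by linarith⟩
  have h1 : 0 ≤ Phi t - Phi u := by
    rw [Phi_eq_max, Phi_eq_max, sub_nonneg]; gcongr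
  have h2 : Phi t - Phi u ≤ t - u := by
    rw [sub_le_iff_le_add, Phi_eq_max, Phi_eq_max]
    refine max_le ?_ ?_
    · linarith [le_max_left (-1) (min u 1)]
    · rcases le_total u 1 with h | h
      · linarith [le_max_right (-1) (min u 1), min_le_left t 1, min_eq_left h]
      · linarith [le_max_right (-1) (min u 1), min_le_right t 1, min_eq_right h]
  have h3 : 0 < t - u := sub_pos.mpr hut
  exact ⟨(Phi t - Phi u) / (t - u), by positivity, (div_le_one h3).mpr h2, by field_simp⟩

/-- The argument of the saturation in the next step. -/
noncomputable def top (lam a : ℝ) (z : ℝ × ℝ) : ℝ := z.2 + vel lam a z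

lemma snd_step_eq_Phi_top (h : |lam| < 1) (z : ℝ × ℝ) :
    (step lam a z).2 = Phi (top lam a z) := snd_step h z

/-- While nothing saturates, `(s, top)` is merely swapped to `(top, s)`; the overshoot `top - Phi
top` is the only correction, damped by `lam`. -/
lemma top_step (h : |lam| < 1) (hb : lam + a = -1) (z : ℝ × ℝ) :
    top lam a (step lam a z) = z.2 + lam * (top lam a z - Phi (top lam a z)) := by
  have ha : a = -1 - lam := by linarith
  unfold top
  rw [vel_step h, snd_step_eq_Phi_top h]
  unfold top
  generalize vel lam a z = d
  rw [ha]; ring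

lemma pt_snd_top_sub (h : |lam| < 1) (z : ℝ × ℝ) :
    pt lam a z.2 (top lam a z - z.2) = z := by
  rw [top, add_sub_cancel_left, pt_eta h]

/-- A difference in `top` splits into a part `θ` passed to `s` and a part `1 - θ` passed to `top`
with factor `lam`, so the `ℓ¹` distance cannot grow. -/
lemma abs_traj_sub_le_of_eq_neg_one (h : |lam| < 1) (hb : lam + a = -1) (z w : ℝ × ℝ) (n : ℕ) :
    |(traj lam a w n).2 - (traj lam a z n).2| +
      |top lam a (traj lam a w n) - top lam a (traj lam a z n)| ≤
    |w.2 - z.2| + |top lam a w - top lam a z| := by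
  induction n with
  | zero => rfl
  | succ n ih =>
    refine le_trans ?_ ih
    rw [traj_succ, traj_succ, snd_step_eq_Phi_top h, snd_step_eq_Phi_top h, top_step h hb,
      top_step h hb]
    generalize traj lam a w n = w'
    generalize traj lam a z n = z'
    obtain ⟨θ, h0, h1, e⟩ := exists_Phi_sub_Phi (top lam a w') (top lam a z')
    rw [e, abs_mul, abs_of_nonneg h0]
    have e2 : w'.2 + lam * (top lam a w' - Phi (top lam a w')) -
        (z'.2 + lam * (top lam a z' - Phi (top lam a z'))) =
        (w'.2 - z'.2) + lam * ((1 - θ) * (top lam a w' - top lam a z')) := by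
      linear_combination (-lam) * e
    rw [e2]
    have h3 : |lam * ((1 - θ) * (top lam a w' - top lam a z'))| ≤
        (1 - θ) * |top lam a w' - top lam a z'| := by
      rw [abs_mul, abs_mul, abs_of_nonneg (sub_nonneg.mpr h1)]
      refine mul_le_of_le_one_left ?_ h.le
      exact mul_nonneg (sub_nonneg.mpr h1) (abs_nonneg _)
    have := abs_add_le (w'.2 - z'.2) (lam * ((1 - θ) * (top lam a w' - top lam a z')))
    linarith

lemma isStable_of_eq_neg_one (h : |lam| < 1) (hb : lam + a = -1) (z : ℝ × ℝ) :
    IsStable lam a z := by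
  -- Passing between the coordinates `(s, top)` and `(s, vel)` costs a factor of at most 2 each way.
  refine isStable_of_linear_bound h (C := 4) one_pos fun w _ _ n => ?_
  have H := abs_traj_sub_le_of_eq_neg_one h hb z w n
  have key : ∀ u v : ℝ × ℝ, |vel lam a u - vel lam a v| ≤
      |u.2 - v.2| + |top lam a u - top lam a v| ∧
      |top lam a u - top lam a v| ≤ |u.2 - v.2| + |vel lam a u - vel lam a v| := by
    intro u v
    constructor
    · have : vel lam a u - vel lam a v =
          (top lam a u - top lam a v) - (u.2 - v.2) := by unfold top; ring
      rw [this]; linarith [abs_sub (top lam a u - top lam a v) (u.2 - v.2)]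
    · have : top lam a u - top lam a v =
          (u.2 - v.2) + (vel lam a u - vel lam a v) := by unfold top; ring
      rw [this]; exact abs_add_le _ _
  have h1 := (key (traj lam a w n) (traj lam a z n)).1
  have h2 := (key w z).2
  have := abs_nonneg (vel lam a w - vel lam a z)
  have := abs_nonneg (top lam a (traj lam a w n) - top lam a (traj lam a z n))
  linarith

lemma abs_eq_abs_Phi_add (t : ℝ) : |t| = |Phi t| + |t - Phi t| := by
  rcases le_total t (-1) with h | h
  · rw [Phi_of_le_neg_one h, abs_of_nonpos (by linarith : t ≤ 0),
      abs_of_nonpos (by linarith : t - -1 ≤ 0)]; norm_num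
  rcases le_total t 1 with h' | h'
  · rw [Phi_of_mem h h']; simp
  · rw [Phi_of_one_le h', abs_of_nonneg (by linarith : 0 ≤ t),
      abs_of_nonneg (by linarith : 0 ≤ t - 1)]; norm_num

/-- Lyapunov argument: by `abs_eq_abs_Phi_add`, the quantity `|s| + |top|` drops at each step by at
least `1 - |lam|` times the overshoot. Being nonnegative, it bounds all partial sums. -/
lemma summable_overshoot (h : |lam| < 1) (hb : lam + a = -1) (z : ℝ × ℝ) :
    Summable fun n => |top lam a (traj lam a z n) - Phi (top lam a (traj lam a z n))| := by
  have h1 : 0 < 1 - |lam| := sub_pos.mpr h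
  set t := fun n => top lam a (traj lam a z n) with ht
  have key : ∀ n, (1 - |lam|) * ∑ i ∈ Finset.range n, |t i - Phi (t i)| ≤
      (|z.2| + |top lam a z|) - (|(traj lam a z n).2| + |t n|) := by
    intro n
    induction n with
    | zero => simp [ht, traj_zero]
    | succ n ih =>
      rw [Finset.sum_range_succ, mul_add]
      have e1 : (traj lam a z (n + 1)).2 = Phi (t n) := by
        rw [traj_succ, snd_step_eq_Phi_top h]
      have e2 : t (n + 1) = (traj lam a z n).2 + lam * (t n - Phi (t n)) := by
        simp only [ht]; rw [traj_succ, top_step h hb]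
      have e3 := abs_add_le (traj lam a z n).2 (lam * (t n - Phi (t n)))
      rw [← e2, abs_mul] at e3
      have e4 := abs_eq_abs_Phi_add (t n)
      rw [e1]; linarith
  refine summable_of_sum_range_le (c := (|z.2| + |top lam a z|) / (1 - |lam|))
    (fun n => abs_nonneg _) fun n => ?_
  rw [le_div_iff₀ h1]
  have := key n
  have := abs_nonneg (traj lam a z n).2
  have := abs_nonneg (t n)
  linarith

lemma top_add_two (h : |lam| < 1) (hb : lam + a = -1) (z : ℝ × ℝ) (n : ℕ) :
    top lam a (traj lam a z (n + 2)) = Phi (top lam a (traj lam a z n)) +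
      lam * (top lam a (traj lam a z (n + 1)) - Phi (top lam a (traj lam a z (n + 1)))) := by
  rw [traj_succ _ (n + 1), top_step h hb, traj_succ _ n, snd_step_eq_Phi_top h]

/-- Over two steps `top` changes only by overshoots, which are summable, so the even terms form a
Cauchy sequence. The overshoot vanishes in the limit. -/
lemma exists_tendsto_top_even (h : |lam| < 1) (hb : lam + a = -1) (z : ℝ × ℝ) :
    ∃ A, Tendsto (fun n => top lam a (traj lam a z (2 * n))) atTop (𝓝 A) ∧ Phi A = A := by
  have hS := summable_overshoot h hb z
  set t := fun n => top lam a (traj lam a z n) with ht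
  have hinj : Function.Injective fun n : ℕ => 2 * n := fun m n e => by simpa using e
  have hinj' : Function.Injective fun n : ℕ => 2 * n + 1 := fun m n e => by simpa using e
  have hd : ∀ n, dist (t (2 * n)) (t (2 * (n + 1))) ≤
      |t (2 * n) - Phi (t (2 * n))| + |t (2 * n + 1) - Phi (t (2 * n + 1))| := by
    intro n
    have e := top_add_two h hb z (2 * n)
    rw [dist_comm, Real.dist_eq]
    have e2 : t (2 * (n + 1)) - t (2 * n) =
        lam * (t (2 * n + 1) - Phi (t (2 * n + 1))) - (t (2 * n) - Phi (t (2 * n))) := by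
      have : 2 * (n + 1) = 2 * n + 2 := by ring
      simp only [ht]; rw [this, e]; ring
    rw [e2]
    refine (abs_sub _ _).trans ?_
    rw [abs_mul, add_comm]
    gcongr
    exact mul_le_of_le_one_left (abs_nonneg _) h.le
  have hc := cauchySeq_of_summable_dist (f := fun n => t (2 * n))
    (Summable.of_nonneg_of_le (fun n => dist_nonneg) hd
      ((hS.comp_injective hinj).add (hS.comp_injective hinj')))
  obtain ⟨A, hA⟩ := cauchySeq_tendsto_of_complete hc
  refine ⟨A, hA, ?_⟩
  have h1 : Tendsto (fun n => t (2 * n) - Phi (t (2 * n))) atTop (𝓝 0) :=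
    (tendsto_zero_iff_abs_tendsto_zero _).mpr (hS.comp_injective hinj).tendsto_atTop_zero
  have h2 := hA.sub ((continuous_Phi.tendsto A).comp hA)
  have := tendsto_nhds_unique h1 h2
  linarith

/-- `Phi` takes an interior value only where it is the identity, so an interior equilibrium has no
preimage but itself. -/
lemma eq_of_step_eq_interior (h : |lam| < 1) (hb : lam + a = -1) {z : ℝ × ℝ} {A : ℝ}
    (hA : |A| < 1) (e : step lam a z = pt lam a A 0) : z = pt lam a A 0 := by
  obtain ⟨h1, h2⟩ := abs_lt.mp hA
  have e1 : Phi (top lam a z) = A := by rw [← snd_step_eq_Phi_top h, e]; rfl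
  have e2 : top lam a z = A := by
    rcases le_total (top lam a z) (-1) with h3 | h3
    · rw [Phi_of_le_neg_one h3] at e1; linarith
    rcases le_total (top lam a z) 1 with h4 | h4
    · rwa [Phi_of_mem h3 h4] at e1
    · rw [Phi_of_one_le h4] at e1; linarith
  have e3 := top_step h hb z
  rw [e, top, vel_pt h, pt_snd, e1, e2] at e3
  have e4 : z.2 = A := by linarith
  have := pt_snd_top_sub (a := a) h z
  rw [e2, e4, sub_self] at this
  exact this.symm

lemma eq_of_traj_eq_interior (h : |lam| < 1) (hb : lam + a = -1) {z : ℝ × ℝ} {A : ℝ}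
    (hA : |A| < 1) (n : ℕ) (e : traj lam a z n = pt lam a A 0) : z = pt lam a A 0 := by
  induction n with
  | zero => exact e
  | succ n ih => exact ih (eq_of_step_eq_interior h hb hA (by rwa [← traj_succ]))

/-- In the coordinates `(s, top)` the parallelogram is the square where nothing saturates. -/
lemma mem_parSigma_iff (h : |lam| < 1) (hb : lam + a = -1) (z : ℝ × ℝ) :
    z ∈ parSigma lam a ↔ |z.2| ≤ 1 ∧ |top lam a z| ≤ 1 := by
  have ha : a = -1 - lam := by linarith
  have h0 := one_sub_pos h
  simp only [parSigma, mem_ofPred_eq, top, vel, abs_le]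
  subst ha
  constructor
  · rintro ⟨h1, h2, h3, h4⟩; exact ⟨⟨h3, h4⟩, by linarith, by linarith⟩
  · rintro ⟨⟨h3, h4⟩, h1, h2⟩; exact ⟨by linarith, by linarith, h3, h4⟩

lemma step_pt_alternate (h : |lam| < 1) (hb : lam + a = -1) {A B : ℝ} (hA : |A| ≤ 1) :
    step lam a (pt lam a B (A - B)) = pt lam a A (B - A) := by
  obtain ⟨h1, h2⟩ := abs_le.mp hA
  rw [step_pt_unsat h (by linarith) (by linarith), hb]
  congr 1 <;> ring

lemma hasPeriod_two_of_ne (h : |lam| < 1) (hb : lam + a = -1) {A B : ℝ} (hA : |A| ≤ 1)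
    (hB : |B| ≤ 1) (hAB : A ≠ B) : HasPeriod lam a 2 (pt lam a B (A - B)) ∧
      pt lam a B (A - B) ∈ parSigma lam a ∧
      step lam a (pt lam a B (A - B)) ∈ parSigma lam a := by
  have key : ∀ A B : ℝ, |A| ≤ 1 → |B| ≤ 1 → pt lam a B (A - B) ∈ parSigma lam a := by
    intro A B hA hB
    rw [mem_parSigma_iff h hb, top, vel_pt h, pt_snd]
    exact ⟨hB, by rwa [add_sub_cancel]⟩
  refine ⟨HasPeriod.of_two hB ?_ ?_, key _ _ hA hB, ?_⟩
  · rw [step_pt_alternate h hb hA, step_pt_alternate h hb hB]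
  · rw [step_pt_alternate h hb hA]
    exact fun e => hAB (pt_injective h e).1
  · rw [step_pt_alternate h hb hA]; exact key _ _ hB hA

lemma segEF_eq (h : |lam| < 1) : segEF lam a = {z | IsEquilibrium lam a z} := by
  have h0 := one_sub_pos h
  ext z
  simp only [segEF, mem_ofPred_eq, isEquilibrium_iff h, strip, abs_le, vel]
  rw [eq_div_iff h0.ne']
  constructor
  · rintro ⟨h1, h2⟩; exact ⟨h2, by linarith⟩
  · rintro ⟨h1, h2⟩; exact ⟨by linarith, h1⟩

lemma parSigma_eq_convexHull (h : |lam| < 1) (hb : lam + a = -1) :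
    parSigma lam a = convexHull ℝ {ptE lam a, ptQ lam a, ptF lam a, -ptQ lam a} := by
  have h2 := one_add_pos h
  have hq : 2 * a / (1 + lam) = -2 := by
    rw [div_eq_iff h2.ne']; linarith
  rw [ptE_eq, ptF_eq, ptQ_eq h, hq, neg_pt, neg_pt]
  apply Subset.antisymm
  · intro z hz
    rw [mem_parSigma_iff h hb] at hz
    obtain ⟨⟨hs1, hs2⟩, ht1, ht2⟩ := hz.imp abs_le.mp abs_le.mp
    set s := z.2
    set t := top lam a z with ht
    set S : Set (ℝ × ℝ) := {pt lam a 1 0, pt lam a 1 (-2), pt lam a (-1) (-0),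
      pt lam a (-1) (- -2)} with hS
    have hE : pt lam a 1 0 ∈ convexHull ℝ S := subset_convexHull ℝ S (by simp [hS])
    have hQ : pt lam a 1 (-2) ∈ convexHull ℝ S := subset_convexHull ℝ S (by simp [hS])
    have hF : pt lam a (-1) (-0) ∈ convexHull ℝ S := subset_convexHull ℝ S (by simp [hS])
    have hQ' : pt lam a (-1) (- -2) ∈ convexHull ℝ S := subset_convexHull ℝ S (by simp [hS])
    have hc := convex_convexHull ℝ S
    -- Bilinear interpolation on the square: first in `top` along the sides `s = 1` and `s = -1`,
    -- then in `s` between them.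
    have hP := hc hE hQ (by linarith : 0 ≤ (1 + t) / 2) (by linarith : 0 ≤ (1 - t) / 2) (by ring)
    have hN := hc hQ' hF (by linarith : 0 ≤ (1 + t) / 2) (by linarith : 0 ≤ (1 - t) / 2) (by ring)
    have hz := hc hP hN (by linarith : 0 ≤ (1 + s) / 2) (by linarith : 0 ≤ (1 - s) / 2) (by ring)
    convert hz using 1
    rw [← pt_snd_top_sub (a := a) h z, ← ht]
    change pt lam a s (t - s) = _
    refine Prod.ext ?_ ?_
    · simp only [pt, Prod.smul_mk, Prod.mk_add_mk, smul_eq_mul]; ring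
    · simp only [pt, Prod.smul_mk, Prod.mk_add_mk, smul_eq_mul]; ring
  · refine convexHull_min ?_ ?_
    · intro z hz
      simp only [mem_insert_iff, mem_singleton_iff] at hz
      rw [mem_parSigma_iff h hb, top]
      rcases hz with rfl | rfl | rfl | rfl <;> rw [vel_pt h, pt_snd] <;> norm_num
    · intro x hx y hy α β hα hβ hαβ
      rw [mem_parSigma_iff h hb] at hx hy ⊢
      have e : top lam a (α • x + β • y) = α * top lam a x + β * top lam a y := by
        simp only [top, vel, Prod.fst_add, Prod.snd_add, Prod.smul_fst, Prod.smul_snd,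
          smul_eq_mul]; ring
      have key : ∀ p q : ℝ, |p| ≤ 1 → |q| ≤ 1 → |α * p + β * q| ≤ 1 := by
        intro p q hp hq
        calc _ ≤ |α * p| + |β * q| := abs_add_le _ _
          _ = α * |p| + β * |q| := by rw [abs_mul, abs_mul, abs_of_nonneg hα, abs_of_nonneg hβ]
          _ ≤ α * 1 + β * 1 := by gcongr
          _ = 1 := by linarith
      rw [e]
      exact ⟨by simpa using key _ _ hx.1 hy.1, key _ _ hx.2 hy.2⟩

lemma converges_of_eq_neg_one (h : |lam| < 1) (hb : lam + a = -1) (z : ℝ × ℝ)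
    (hne : ¬ IsEquilibrium lam a z) :
    ConvergesTo lam a z (ptE lam a) ∨ ConvergesTo lam a z (ptF lam a) ∨
      ∃ q ∈ parSigma lam a, HasPeriod lam a 2 q ∧ step lam a q ∈ parSigma lam a ∧
        ConvergesToOrbit lam a z q := by
  obtain ⟨A, hA, hPA⟩ := exists_tendsto_top_even h hb z
  -- The even terms of the shifted trajectory are the odd terms of the original one.
  obtain ⟨B, hB, hPB⟩ := exists_tendsto_top_even h hb (step lam a z)
  have hA1 : |A| ≤ 1 := hPA ▸ abs_Phi_le A
  have hB1 : |B| ≤ 1 := hPB ▸ abs_Phi_le B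
  have hB' : Tendsto (fun n => top lam a (traj lam a z (2 * n + 1))) atTop (𝓝 B) :=
    hB.congr fun n => by rw [traj_succ']
  have hsodd : Tendsto (fun n => (traj lam a z (2 * n + 1)).2) atTop (𝓝 A) := by
    have := (continuous_Phi.tendsto A).comp hA
    rw [hPA] at this
    exact this.congr fun n => by rw [traj_succ, snd_step_eq_Phi_top h]; rfl
  have hseven : Tendsto (fun n => (traj lam a z (2 * n)).2) atTop (𝓝 B) := by
    have := (continuous_Phi.tendsto B).comp hB'
    rw [hPB] at this
    refine (tendsto_add_atTop_iff_nat 1).mp (this.congr fun n => ?_)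
    rw [mul_add, mul_one, traj_succ _ (2 * n + 1), snd_step_eq_Phi_top h]; rfl
  have heven : Tendsto (fun n => traj lam a z (2 * n)) atTop (𝓝 (pt lam a B (A - B))) :=
    (tendsto_pt hseven (hA.sub hseven)).congr fun n => pt_snd_top_sub h _
  have hodd : Tendsto (fun n => traj lam a z (2 * n + 1)) atTop (𝓝 (pt lam a A (B - A))) :=
    (tendsto_pt hsodd (hB'.sub hsodd)).congr fun n => pt_snd_top_sub h _
  rcases eq_or_ne A B with rfl | hAB
  · rw [sub_self] at heven hodd
    have hconv : ConvergesTo lam a z (pt lam a A 0) := tendsto_of_even_of_odd heven hodd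
    rcases hA1.lt_or_eq with hlt | heq
    -- An interior common limit is impossible: eventually nothing saturates, so `top` is exactly
    -- 2-periodic and, converging, constant. The trajectory then hits an interior equilibrium, which
    -- only that equilibrium itself reaches.
    · exfalso
      have htop : Tendsto (fun n => top lam a (traj lam a z n)) atTop (𝓝 A) :=
        tendsto_of_even_of_odd hA hB'
      obtain ⟨N, hN⟩ := eventually_atTop.mp (htop.abs.eventually_lt_const hlt)
      have hunsat : ∀ n ≥ N, Phi (top lam a (traj lam a z n)) = top lam a (traj lam a z n) := by
        intro n hn
        obtain ⟨h1, h2⟩ := abs_lt.mp (hN n hn)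
        exact Phi_of_mem h1.le h2.le
      have hper : ∀ n ≥ N, top lam a (traj lam a z (n + 2)) = top lam a (traj lam a z n) := by
        intro n hn
        rw [top_add_two h hb, hunsat n hn, hunsat (n + 1) (by omega)]; ring
      have hconst : ∀ n ≥ N, top lam a (traj lam a z n) = A := by
        intro n hn
        have h1 : ∀ k, top lam a (traj lam a z (n + 2 * k)) = top lam a (traj lam a z n) := by
          intro k
          induction k with
          | zero => rfl
          | succ k ih => rw [← ih, mul_add, mul_one, ← add_assoc, hper _ (by omega)]
        have h2 : Tendsto (fun k => top lam a (traj lam a z (n + 2 * k))) atTop (𝓝 A) := by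
          refine htop.comp (tendsto_atTop_mono (fun k => ?_) tendsto_id)
          simp only [id]; omega
        simp only [h1] at h2
        exact tendsto_nhds_unique tendsto_const_nhds h2
      have hs : (traj lam a z (N + 1)).2 = A := by
        rw [traj_succ, snd_step_eq_Phi_top h, hunsat N le_rfl, hconst N le_rfl]
      have he : traj lam a z (N + 1) = pt lam a A 0 := by
        rw [← pt_snd_top_sub (a := a) h (traj lam a z (N + 1)), hconst (N + 1) (by omega), hs,
          sub_self]
      refine hne ?_
      rw [eq_of_traj_eq_interior h hb hlt (N + 1) he, isEquilibrium_pt h]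
      exact ⟨hA1, rfl⟩
    · rcases eq_or_eq_neg_of_abs_eq heq with rfl | rfl
      · left; rwa [ptE_eq]
      · right; left; rw [ptF_eq, neg_pt, neg_zero]; exact hconv
  · right; right
    obtain ⟨h1, h2, h3⟩ := hasPeriod_two_of_ne h hb hA1 hB1 hAB
    refine ⟨_, h2, h1, h3, 0, ?_⟩
    have e0 : ∀ n, traj lam a (pt lam a B (A - B)) (2 * n) = pt lam a B (A - B) := by
      intro n
      induction n with
      | zero => rfl
      | succ n ih =>
        rw [mul_add, mul_one, traj_succ, traj_succ, ih, step_pt_alternate h hb hA1,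
          step_pt_alternate h hb hB1]
    refine tendsto_of_even_of_odd ?_ ?_
    · simp only [add_zero, e0]
      exact tendsto_iff_dist_tendsto_zero.mp heven
    · simp only [add_zero, traj_succ (pt lam a B (A - B)), e0, step_pt_alternate h hb hA1]
      exact tendsto_iff_dist_tendsto_zero.mp hodd

/-- The boundary case `lam + a = -1`. -/
lemma case_eq_neg_one (h : |lam| < 1) (hb : lam + a = -1) :
    (∀ z, IsEquilibrium lam a z → IsStable lam a z) ∧
    ptQ lam a = (1, 1) ∧
    parSigma lam a = convexHull ℝ {ptE lam a, ptQ lam a, ptF lam a, -ptQ lam a} ∧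
    segEF lam a ⊆ parSigma lam a ∧
    (∀ z ∈ segEF lam a, IsEquilibrium lam a z) ∧
    (∀ z ∈ parSigma lam a \ segEF lam a,
      HasPeriod lam a 2 z ∧ step lam a z ∈ parSigma lam a ∧ IsStable lam a z) ∧
    (∀ z ∈ strip, ¬ IsEquilibrium lam a z →
      ConvergesTo lam a z (ptE lam a) ∨ ConvergesTo lam a z (ptF lam a) ∨
      ∃ q ∈ parSigma lam a, HasPeriod lam a 2 q ∧ step lam a q ∈ parSigma lam a ∧
        ConvergesToOrbit lam a z q) := by
  refine ⟨fun z _ => isStable_of_eq_neg_one h hb z, ?_, parSigma_eq_convexHull h hb, ?_, ?_, ?_,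
    fun z _ hne => converges_of_eq_neg_one h hb z hne⟩
  · refine Prod.ext ?_ rfl
    have := one_add_pos h
    simp only [ptQ]
    rw [← neg_div, div_eq_iff this.ne']; linarith
  · intro z hz
    rw [segEF_eq h] at hz
    have := (isEquilibrium_iff h).mp hz
    rw [mem_parSigma_iff h hb, top, this.2, add_zero]
    exact ⟨this.1, this.1⟩
  · intro z hz; rwa [segEF_eq h] at hz
  · rintro z ⟨hz, hne⟩
    rw [segEF_eq h] at hne
    rw [mem_parSigma_iff h hb] at hz
    have e := pt_snd_top_sub (a := a) h z
    have hAB : top lam a z ≠ z.2 := by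
      intro e2
      refine hne ?_
      rw [e2, sub_self] at e
      rw [← e]
      exact (isEquilibrium_pt h).mpr ⟨hz.1, rfl⟩
    obtain ⟨h1, -, h3⟩ := hasPeriod_two_of_ne h hb hz.2 hz.1 hAB
    rw [e] at h1 h3
    exact ⟨h1, h3, isStable_of_eq_neg_one h hb z⟩

/-! ### Moving towards saturation when `1 ≤ lam + a` -/

/-- Without saturation the velocity never falls below `d`, so `s` would advance by at least `d` at
every step and leave the strip. -/
lemma exists_saturating (h : |lam| < 1) (hb : 1 ≤ lam + a) {s d : ℝ} (hs : |s| ≤ 1)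
    (hd : 0 < d) : ∃ n s' d', traj lam a (pt lam a s d) n = pt lam a s' d' ∧ s ≤ s' ∧ s' ≤ 1 ∧
      d ≤ d' ∧ 1 < s' + d' := by
  by_contra! H
  obtain ⟨h1, h2⟩ := abs_le.mp hs
  have key : ∀ n : ℕ, ∃ s' d', traj lam a (pt lam a s d) n = pt lam a s' d' ∧
      s + n * d ≤ s' ∧ s' ≤ 1 ∧ d ≤ d' := by
    intro n
    induction n with
    | zero => exact ⟨s, d, rfl, by simp, h2, le_rfl⟩
    | succ n ih =>
      obtain ⟨s', d', e, h3, h4, h5⟩ := ih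
      have h6 : s ≤ s' := le_trans (by have : 0 ≤ n * d := by positivity
                                       linarith) h3
      have h7 := H n s' d' e h6 h4 h5
      refine ⟨s' + d', (lam + a) * d', ?_, ?_, h7, ?_⟩
      · rw [traj_succ, e, step_pt_unsat h (by linarith) h7]
      · push_cast; linarith
      · nlinarith
  obtain ⟨n, hn⟩ := exists_nat_gt ((1 - s) / d)
  rw [div_lt_iff₀ hd] at hn
  obtain ⟨s', d', -, h3, h4, -⟩ := key n
  linarith

lemma exists_snd_eq_one (h : |lam| < 1) (hb : 1 ≤ lam + a) {s d : ℝ} (hs : |s| ≤ 1)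
    (hd : 0 < d) : ∃ n, (traj lam a (pt lam a s d) n).2 = 1 := by
  obtain ⟨n, s', d', e, -, -, -, h1⟩ := exists_saturating h hb hs hd
  exact ⟨n + 1, by rw [traj_succ, e, step_pt_top h h1.le, pt_snd]⟩

lemma not_isStable_of_one_le (h : |lam| < 1) (hb : 1 ≤ lam + a) (z : ℝ × ℝ)
    (hz : IsEquilibrium lam a z) : ¬ IsStable lam a z := by
  -- By symmetry there is room above `z`; an arbitrarily small upward velocity then carries `s` all
  -- the way to 1.
  wlog hz1 : z.2 < 1 generalizing z
  · intro hs
    have h1 : z.2 ≤ 1 := (abs_le.mp (show |z.2| ≤ 1 from hz.1)).2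
    refine this (-z) (isEquilibrium_neg.mpr hz) ?_ hs.neg
    rw [Prod.snd_neg]; linarith
  refine not_isStable_of_escape hz (sub_pos.mpr hz1) fun δ hδ => ?_
  obtain ⟨η, hη, H⟩ := exists_dist_pt_lt (lam := lam) (a := a) z.2 hδ
  obtain ⟨n, hn⟩ := exists_snd_eq_one h hb (d := η / 2) hz.1 (by positivity)
  refine ⟨pt lam a z.2 (η / 2), hz.1, ?_, n, ?_⟩
  · rw [hz.eq_pt h]
    exact H _ _ (by simpa using hη) (by rw [abs_of_pos (by positivity)]; linarith)
  · have := abs_snd_sub_le (traj lam a (pt lam a z.2 (η / 2)) n) z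
    rw [hn] at this
    exact (le_abs_self _).trans this

/-! ### Semi-stability of the end points -/

lemma traj_outward (h : |lam| < 1) (hl : 0 ≤ lam) {d : ℝ} (hd : 0 ≤ d) (n : ℕ) :
    traj lam a (pt lam a 1 d) n = pt lam a 1 (lam ^ n * d) := by
  induction n with
  | zero => simp [traj_zero]
  | succ n ih =>
    have : 0 ≤ lam ^ n * d := by positivity
    rw [traj_succ, ih, step_pt_top h (by linarith)]
    congr 1; ring

lemma converges_outward (h : |lam| < 1) (hl : 0 ≤ lam) {d : ℝ} (hd : 0 ≤ d) :
    ConvergesTo lam a (pt lam a 1 d) (ptE lam a) := by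
  unfold ConvergesTo
  rw [funext (traj_outward h hl hd), ptE_eq]
  refine tendsto_pt tendsto_const_nhds ?_
  simpa using (tendsto_pow_atTop_nhds_zero_of_lt_one hl (abs_lt.mp h).2).mul_const d

/-- `E` is approached along a ray; `c` is the ratio of velocity to the depth `1 - s`, to be chosen
so that the ray lies in `U`. -/
lemma mem_frontier_ptE {U : Set (ℝ × ℝ)} (hU : IsOpen U) (hsub : U ⊆ {w | |w.2| < 1})
    (c : ℝ) (H : ∀ η : ℝ, 0 < η → η < 1 → pt lam a (1 - η) (c * η) ∈ U) :
    ptE lam a ∈ frontier U := by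
  rw [hU.frontier_eq]
  refine ⟨Metric.mem_closure_iff.mpr fun ε hε => ?_, fun hE => ?_⟩
  · rw [ptE_eq]
    obtain ⟨η, hη, hd⟩ := exists_dist_pt_lt (lam := lam) (a := a) 1 hε
    set ν : ℝ := min (1 / 2) (η / (|c| + 2)) with hν
    have hpos : 0 < ν := by positivity
    have h1 : ν * (|c| + 2) ≤ η := by
      rw [← le_div_iff₀ (by positivity)]; exact min_le_right _ _
    have h2 : ν ≤ 1 / 2 := min_le_left _ _
    have h3 : 0 ≤ ν * |c| := by positivity
    refine ⟨_, H ν hpos (by linarith), ?_⟩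
    rw [dist_comm]
    refine hd _ _ ?_ ?_
    · rw [sub_sub_cancel_left, abs_neg, abs_of_pos hpos]; linarith
    · rw [abs_mul, abs_of_pos hpos]; linarith
  · have := hsub hE
    simp [ptE] at this

lemma exists_le_dist_of_converges {z q : ℝ × ℝ} (hz : ConvergesTo lam a z q) (p : ℝ × ℝ) :
    ∃ n, dist q p / 2 ≤ dist (traj lam a z n) p := by
  rcases eq_or_ne q p with rfl | hqp
  · exact ⟨0, by simp⟩
  have h1 : dist q p / 2 < dist q p := half_lt_self (dist_pos.mpr hqp)
  have h2 := (hz.dist (tendsto_const_nhds (x := p))).eventually_const_lt h1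
  obtain ⟨n, hn⟩ := h2.exists
  exact ⟨n, hn.le⟩

lemma ptE_ne_ptF : ptE lam a ≠ ptF lam a := by
  intro e
  have := congrArg Prod.snd e
  norm_num [ptE, ptF] at this

lemma converges_ptE_of_pos (h : |lam| < 1) (hl : 0 ≤ lam) (hb : 1 ≤ lam + a) {z : ℝ × ℝ}
    (hz : z ∈ strip) (hd : 0 < vel lam a z) : ConvergesTo lam a z (ptE lam a) := by
  obtain ⟨n, s', d', e, -, h1, h2, h3⟩ := exists_saturating h hb (s := z.2) hz hd
  rw [pt_eta h] at e
  refine convergesTo_of_traj (n + 1) ?_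
  rw [traj_succ, e, step_pt_top h h3.le]
  have ha : 0 ≤ a := by linarith [(abs_lt.mp h).2]
  refine converges_outward h hl ?_
  have := mul_nonneg hl (hd.le.trans h2)
  have := mul_nonneg ha (sub_nonneg.mpr h1)
  linarith

lemma vel_neg (z : ℝ × ℝ) : vel lam a (-z) = -vel lam a z := by
  simp only [vel, Prod.fst_neg, Prod.snd_neg]; ring

lemma converges_ptF_of_neg (h : |lam| < 1) (hl : 0 ≤ lam) (hb : 1 ≤ lam + a) {z : ℝ × ℝ}
    (hz : z ∈ strip) (hd : vel lam a z < 0) : ConvergesTo lam a z (ptF lam a) := by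
  have := (converges_ptE_of_pos h hl hb (neg_mem_strip.mpr hz)
    (by rw [vel_neg]; linarith)).neg
  rwa [neg_neg, ptE_eq, ← ptF_eq] at this

/-- Both `lam` and `lam + a` are nonnegative, so the velocity keeps its sign; it is the increment of
`x`, and a nonnegative fraction of it is the increment of `s`. -/
lemma traj_monotone_of_nonneg (h : |lam| < 1) (hl : 0 ≤ lam) (hb : 1 ≤ lam + a) {z : ℝ × ℝ}
    (hz : z ∈ strip) (hd : 0 ≤ vel lam a z) :
    Monotone (fun n => (traj lam a z n).1) ∧ Monotone (fun n => (traj lam a z n).2) := by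
  have hv : ∀ n, 0 ≤ vel lam a (traj lam a z n) := by
    intro n
    induction n with
    | zero => exact hd
    | succ n ih =>
      obtain ⟨θ, h0, h1, -, e⟩ := exists_step_factor (a := a) h (traj_mem_strip (a := a) hz n)
      rw [traj_succ, e]
      refine mul_nonneg (add_nonneg (mul_nonneg (sub_nonneg.mpr h1) hl)
        (mul_nonneg h0 (by linarith))) ih
  constructor
  · refine monotone_nat_of_le_succ fun n => ?_
    have := hv n
    rw [traj_succ]
    simp only [step, vel] at *
    linarith
  · refine monotone_nat_of_le_succ fun n => ?_
    obtain ⟨θ, h0, h1, e, -⟩ := exists_step_factor (a := a) h (traj_mem_strip (a := a) hz n)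
    have := mul_nonneg h0 (hv n)
    rw [traj_succ]; linarith

lemma mem_strip_of_lt {w : ℝ × ℝ} (hw : |w.2| < 1) : w ∈ strip := hw.le

lemma isOpen_snd_lt : IsOpen {w : ℝ × ℝ | |w.2| < 1} :=
  isOpen_lt (by fun_prop) (by fun_prop)

lemma isSemiStable_ptE_of_one_le (h : |lam| < 1) (hl : 0 ≤ lam) (hb : 1 ≤ lam + a) :
    IsSemiStable lam a (ptE lam a) := by
  have hv := continuous_vel (lam := lam) (a := a)
  have ho1 : IsOpen ({w : ℝ × ℝ | |w.2| < 1} ∩ {w | 0 < vel lam a w}) :=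
    isOpen_snd_lt.inter (isOpen_lt (by fun_prop) (by fun_prop))
  have ho2 : IsOpen ({w : ℝ × ℝ | |w.2| < 1} ∩ {w | vel lam a w < 0}) :=
    isOpen_snd_lt.inter (isOpen_lt (by fun_prop) (by fun_prop))
  refine ⟨isEquilibrium_ptE h, _, _, ho1, ho2, inter_subset_left, inter_subset_left,
    mem_frontier_ptE ho1 inter_subset_left 1 fun η h0 h1 => ?_,
    mem_frontier_ptE ho2 inter_subset_left (-1) fun η h0 h1 => ?_,
    -- `δ = ε` suffices: both coordinates increase to those of `E`, so the distance to `E` never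
    -- exceeds its initial value. Points of the second set converge to `F`, hence escape.
    fun ε hε => ⟨ε, hε, fun w hw hd n _ => ?_⟩,
    dist (ptF lam a) (ptE lam a) / 2, half_pos (dist_pos.mpr ptE_ne_ptF.symm), fun w hw => ?_⟩
  · refine ⟨?_, ?_⟩
    · change |1 - η| < 1
      rw [abs_lt]; constructor <;> linarith
    · change 0 < vel lam a _
      rw [vel_pt h]; linarith
  · refine ⟨?_, ?_⟩
    · change |1 - η| < 1
      rw [abs_lt]; constructor <;> linarith
    · change vel lam a _ < 0
      rw [vel_pt h]; linarith
  · have hw1 : w ∈ strip := mem_strip_of_lt hw.1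
    have hw2 : 0 < vel lam a w := hw.2
    obtain ⟨m1, m2⟩ := traj_monotone_of_nonneg h hl hb hw1 hw2.le
    have hc := converges_ptE_of_pos h hl hb hw1 hw2
    have c1 := m1.ge_of_tendsto ((continuous_fst.tendsto _).comp hc) n
    have c2 := m2.ge_of_tendsto ((continuous_snd.tendsto _).comp hc) n
    have c3 := m1 (Nat.zero_le n)
    have c4 := m2 (Nat.zero_le n)
    simp only [traj_zero] at c1 c2 c3 c4
    refine lt_of_le_of_lt ?_ hd
    rw [Prod.dist_eq, Prod.dist_eq, Real.dist_eq, Real.dist_eq, Real.dist_eq, Real.dist_eq]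
    refine max_le_max ?_ ?_
    · rw [abs_sub_comm, abs_sub_comm w.1, abs_of_nonneg (by linarith), abs_of_nonneg (by linarith)]
      linarith
    · rw [abs_sub_comm, abs_sub_comm w.2, abs_of_nonneg (by linarith), abs_of_nonneg (by linarith)]
      linarith
  · exact exists_le_dist_of_converges
      (converges_ptF_of_neg h hl hb (mem_strip_of_lt hw.1) hw.2) _

lemma ptF_eq_neg : ptF lam a = -ptE lam a := by rw [ptE_eq, ptF_eq]

lemma case_one_le (h : |lam| < 1) (hl : 0 ≤ lam) (hb : 1 ≤ lam + a) :
    IsSemiStable lam a (ptE lam a) ∧ IsSemiStable lam a (ptF lam a) ∧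
    (∀ z, IsEquilibrium lam a z → z ≠ ptE lam a → z ≠ ptF lam a → ¬ IsStable lam a z) ∧
    (∀ z ∈ strip, ¬ IsEquilibrium lam a z →
      ConvergesTo lam a z (ptE lam a) ∨ ConvergesTo lam a z (ptF lam a)) := by
  have hE := isSemiStable_ptE_of_one_le h hl hb
  refine ⟨hE, by rw [ptF_eq_neg]; exact hE.neg,
    fun z hz _ _ => not_isStable_of_one_le h hb z hz, fun z hz hne => ?_⟩
  have hv : vel lam a z ≠ 0 := fun e => hne ((isEquilibrium_iff h).mpr ⟨hz, e⟩)
  rcases hv.lt_or_gt with hv | hv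
  · exact Or.inr (converges_ptF_of_neg h hl hb hz hv)
  · exact Or.inl (converges_ptE_of_pos h hl hb hz hv)

/-! ### The boundary case `lam + a = 1`, `lam < 0` -/

/-- The velocity after saturation lies between `lam * d` and `d`. If it is nonpositive it is already
small enough; if positive, the next step stays at `s = 1` and multiplies it by `lam`. -/
lemma exists_abs_vel_le (h : |lam| < 1) (hl : lam < 0) (hb : lam + a = 1) {z : ℝ × ℝ}
    (hz : z ∈ strip) : ∃ n, |vel lam a (traj lam a z n)| ≤ |lam| * |vel lam a z| := by
  wlog hv : 0 < vel lam a z generalizing z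
  · rcases (not_lt.mp hv).eq_or_lt with e | hlt
    · exact ⟨0, by simp [traj_zero, e]⟩
    · obtain ⟨n, hn⟩ := this (neg_mem_strip.mpr hz) (by rw [vel_neg]; linarith)
      rw [traj_neg, vel_neg, vel_neg, abs_neg, abs_neg] at hn
      exact ⟨n, hn⟩
  have hbound := abs_vel_traj_le (a := a) h (q := 1) h.le (by rw [hb]; simp) hz
  obtain ⟨n, s, d, e, -, h1, h2, h3⟩ := exists_saturating h hb.ge (s := z.2) hz hv
  rw [pt_eta h] at e
  have hd : d ≤ vel lam a z := by
    have := hbound n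
    rw [e, vel_pt h, one_pow, mul_one, abs_of_pos hv] at this
    exact (le_abs_self d).trans this
  have hd0 : 0 < d := hv.trans_le h2
  have ha : 0 < a := by linarith
  set d' := lam * d + a * (1 - s) with hd'
  have e1 : traj lam a z (n + 1) = pt lam a 1 d' := by
    rw [traj_succ, e, step_pt_top h h3.le]
  have h4 : d' ≤ d := by
    -- Saturation means `1 - s ≤ d`, and `lam * d + a * d = d`.
    have : a * (1 - s) ≤ a * d := by gcongr; linarith
    have : d = lam * d + a * d := by rw [← add_mul, hb, one_mul]
    linarith
  have h5 : lam * d ≤ d' := by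
    have := mul_nonneg ha.le (sub_nonneg.mpr h1)
    linarith
  rw [abs_of_pos hv, abs_of_neg hl]
  rcases le_total d' 0 with h6 | h6
  · refine ⟨n + 1, ?_⟩
    rw [e1, vel_pt h, abs_of_nonpos h6]
    nlinarith
  · refine ⟨n + 2, ?_⟩
    rw [traj_succ, e1, step_pt_top h (by linarith), vel_pt h, sub_self, mul_zero, add_zero,
      abs_mul, abs_of_neg hl, abs_of_nonneg h6]
    nlinarith

lemma tendsto_vel_of_eq_one (h : |lam| < 1) (hl : lam < 0) (hb : lam + a = 1) {z : ℝ × ℝ}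
    (hz : z ∈ strip) : Tendsto (fun n => vel lam a (traj lam a z n)) atTop (𝓝 0) := by
  have hpow : ∀ i : ℕ, ∃ n, |vel lam a (traj lam a z n)| ≤ |lam| ^ i * |vel lam a z| := by
    intro i
    induction i with
    | zero => exact ⟨0, by simp [traj_zero]⟩
    | succ i ih =>
      obtain ⟨n, hn⟩ := ih
      obtain ⟨m, hm⟩ := exists_abs_vel_le h hl hb (traj_mem_strip (a := a) hz n)
      refine ⟨n + m, ?_⟩
      rw [traj_add]
      calc _ ≤ |lam| * (|lam| ^ i * |vel lam a z|) := by
            refine hm.trans (mul_le_mul_of_nonneg_left hn (abs_nonneg _))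
        _ = _ := by ring
  rw [Metric.tendsto_atTop]
  intro ε hε
  have h1 : Tendsto (fun i : ℕ => |lam| ^ i * |vel lam a z|) atTop (𝓝 0) := by
    simpa using (tendsto_pow_atTop_nhds_zero_of_lt_one (abs_nonneg lam) h).mul_const |vel lam a z|
  obtain ⟨i, hi⟩ := (h1.eventually_lt_const hε).exists
  obtain ⟨N, hN⟩ := hpow i
  refine ⟨N, fun n hn => ?_⟩
  obtain ⟨m, rfl⟩ := Nat.exists_eq_add_of_le hn
  have := abs_vel_traj_le (a := a) h (q := 1) h.le (by rw [hb]; simp)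
    (traj_mem_strip (lam := lam) (a := a) hz N) m
  rw [one_pow, mul_one, ← traj_add] at this
  rw [Real.dist_eq, sub_zero]
  linarith

lemma case_eq_one (h : |lam| < 1) (hl : lam < 0) (hb : lam + a = 1) :
    (∀ z, IsEquilibrium lam a z → ¬ IsStable lam a z) ∧
    (∀ z ∈ strip, Tendsto (fun n => Metric.infDist (traj lam a z n) (segEF lam a))
      atTop (𝓝 0)) := by
  refine ⟨not_isStable_of_one_le h hb.ge, fun z hz => ?_⟩
  have hv := tendsto_vel_of_eq_one h hl hb hz
  refine squeeze_zero (fun n => Metric.infDist_nonneg) (fun n => ?_)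
    (g := fun n => ((|a| + 1) / (1 - lam) + 1) * |vel lam a (traj lam a z n)|)
    (by simpa using hv.abs.const_mul ((|a| + 1) / (1 - lam) + 1))
  have hmem : pt lam a (traj lam a z n).2 0 ∈ segEF lam a := by
    rw [segEF_eq h]
    exact (isEquilibrium_pt h).mpr ⟨traj_mem_strip hz n, rfl⟩
  refine (Metric.infDist_le_dist_of_mem hmem).trans ((dist_le_coords (a := a) h _ _).trans_eq ?_)
  rw [vel_pt h, pt_snd, sub_self, abs_zero, zero_add, sub_zero]

/-! ### Attraction to the two-periodic orbit when `lam + a < -1` -/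

/-- The velocities at `s = -1` from which the trajectory jumps between the saturated levels
forever. -/
def jumpVel (lam a : ℝ) : Set ℝ := {D | 2 ≤ D ∧ (0 ≤ lam → D ≤ -2 * a - 2 * lam)}

lemma step_pt_jump (h : |lam| < 1) {D : ℝ} (hD : 2 ≤ D) :
    step lam a (pt lam a (-1) D) = -pt lam a (-1) (-2 * a - lam * D) := by
  rw [step_pt_top h (by linarith), neg_pt]
  congr 1 <;> ring

/-- For `lam ≥ 0` the next jump velocity decreases in `D`: `D ≥ 2` yields the upper bound, and the
upper bound yields `≥ 2` by the same computation as in `one_lt_growth`. For `lam < 0` it is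
nondecreasing and no upper bound is needed. -/
lemma jumpVel_next (h : |lam| < 1) (hb : lam + a < -1) {D : ℝ} (hD : D ∈ jumpVel lam a) :
    -2 * a - lam * D ∈ jumpVel lam a := by
  obtain ⟨h1, h2⟩ := hD
  have h3 := one_sub_pos h
  rcases le_or_gt 0 lam with hl | hl
  · have h4 := mul_le_mul_of_nonneg_left h1 hl
    have h5 := mul_le_mul_of_nonneg_left (h2 hl) hl
    have h6 := mul_pos h3 (by linarith : 0 < -1 - lam - a)
    exact ⟨by linarith, fun _ => by linarith⟩
  · have h4 := mul_le_mul_of_nonpos_left h1 hl.le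
    exact ⟨by linarith, fun h' => absurd h' (not_le.mpr hl)⟩

/-- All jump trajectories visit the same levels at the same times, and each jump is affine in the
velocity with slope `lam`. -/
lemma traj_jump_sub (h : |lam| < 1) (hb : lam + a < -1) (n : ℕ) : ∀ {D D' : ℝ},
    D ∈ jumpVel lam a → D' ∈ jumpVel lam a →
    (traj lam a (pt lam a (-1) D) n).2 = (traj lam a (pt lam a (-1) D') n).2 ∧
    vel lam a (traj lam a (pt lam a (-1) D) n) - vel lam a (traj lam a (pt lam a (-1) D') n) =
      lam ^ n * (D - D') := by
  induction n with
  | zero => intro D D' _ _; simp [traj_zero, vel_pt h]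
  | succ n ih =>
    intro D D' hD hD'
    obtain ⟨h1, h2⟩ := ih (jumpVel_next h hb hD) (jumpVel_next h hb hD')
    rw [traj_succ', traj_succ', step_pt_jump h hD.1, step_pt_jump h hD'.1, traj_neg, traj_neg,
      vel_neg, vel_neg, Prod.snd_neg, Prod.snd_neg, h1]
    refine ⟨rfl, ?_⟩
    rw [pow_succ]; linear_combination -h2

/-- The velocity at `-Q`. -/
lemma neg_ptQ_eq (h : |lam| < 1) : -ptQ lam a = pt lam a (-1) (-2 * a / (1 + lam)) := by
  rw [ptQ_eq h, neg_pt]; congr 1; ring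

lemma two_lt_velQ (h : |lam| < 1) (hb : lam + a < -1) : 2 < -2 * a / (1 + lam) := by
  rw [lt_div_iff₀ (one_add_pos h)]; linarith

lemma velQ_fixed (h : |lam| < 1) :
    -2 * a - lam * (-2 * a / (1 + lam)) = -2 * a / (1 + lam) := by
  have := (one_add_pos h).ne'
  field_simp; ring

lemma velQ_mem (h : |lam| < 1) (hb : lam + a < -1) : -2 * a / (1 + lam) ∈ jumpVel lam a := by
  have h1 := two_lt_velQ h hb
  refine ⟨h1.le, fun hl => ?_⟩
  have h2 := velQ_fixed (a := a) h
  have := mul_le_mul_of_nonneg_left h1.le hl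
  linarith

lemma step_neg_ptQ (h : |lam| < 1) (hb : lam + a < -1) :
    step lam a (-ptQ lam a) = ptQ lam a := by
  rw [neg_ptQ_eq h, step_pt_jump h (two_lt_velQ h hb).le, velQ_fixed h, ← neg_ptQ_eq h, neg_neg]

lemma step_ptQ (h : |lam| < 1) (hb : lam + a < -1) :
    step lam a (ptQ lam a) = -ptQ lam a := by
  rw [← neg_neg (ptQ lam a), step_neg, step_neg_ptQ h hb, neg_neg]

lemma traj_ptQ_succ (h : |lam| < 1) (hb : lam + a < -1) (n : ℕ) :
    traj lam a (ptQ lam a) (n + 1) = -traj lam a (ptQ lam a) n := by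
  rw [traj_succ', step_ptQ h hb, traj_neg]

lemma traj_ptQ_add_two_mul (h : |lam| < 1) (hb : lam + a < -1) (n m : ℕ) :
    traj lam a (ptQ lam a) (n + 2 * m) = traj lam a (ptQ lam a) n := by
  induction m with
  | zero => rfl
  | succ m ih =>
    rw [mul_add, mul_one, ← add_assoc, traj_ptQ_succ h hb, traj_ptQ_succ h hb, neg_neg, ih]

lemma traj_ptQ_cases (h : |lam| < 1) (hb : lam + a < -1) (n : ℕ) :
    traj lam a (ptQ lam a) n = ptQ lam a ∨ traj lam a (ptQ lam a) n = -ptQ lam a := by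
  induction n with
  | zero => exact Or.inl rfl
  | succ n ih =>
    rw [traj_ptQ_succ h hb]
    rcases ih with e | e <;> rw [e]
    · exact Or.inr rfl
    · exact Or.inl (neg_neg _)

lemma ConvergesToOrbit.neg_ptQ (h : |lam| < 1) (hb : lam + a < -1) {z : ℝ × ℝ}
    (hz : ConvergesToOrbit lam a z (ptQ lam a)) : ConvergesToOrbit lam a (-z) (ptQ lam a) := by
  obtain ⟨k, hk⟩ := hz
  refine ⟨k + 1, hk.congr fun n => ?_⟩
  rw [← add_assoc, traj_ptQ_succ h hb, traj_neg, dist_neg_neg]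

lemma convergesToOrbit_of_traj (h : |lam| < 1) (hb : lam + a < -1) {z : ℝ × ℝ} (m : ℕ)
    (hz : ConvergesToOrbit lam a (traj lam a z m) (ptQ lam a)) :
    ConvergesToOrbit lam a z (ptQ lam a) := by
  obtain ⟨k, hk⟩ := hz
  refine ⟨k + m, (tendsto_add_atTop_iff_nat m).mp (hk.congr fun n => ?_)⟩
  have : n + m + (k + m) = n + k + 2 * m := by ring
  rw [this, traj_ptQ_add_two_mul h hb, ← traj_add, add_comm m n]

lemma convergesToOrbit_jump (h : |lam| < 1) (hb : lam + a < -1) {D : ℝ}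
    (hD : D ∈ jumpVel lam a) : ConvergesToOrbit lam a (pt lam a (-1) D) (ptQ lam a) := by
  -- Phase 1, because the comparison orbit must start at `-Q`, on the level `s = -1`.
  refine ⟨1, ?_⟩
  set C : ℝ := (|a| + 1) / (1 - lam) + 1
  have hlim : Tendsto (fun n : ℕ => C * (|lam| ^ n * |D - -2 * a / (1 + lam)|)) atTop (𝓝 0) := by
    simpa using ((tendsto_pow_atTop_nhds_zero_of_lt_one (abs_nonneg lam) h).mul_const
      |D - -2 * a / (1 + lam)|).const_mul C
  refine squeeze_zero (fun n => dist_nonneg) (fun n => ?_) hlim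
  obtain ⟨h1, h2⟩ := traj_jump_sub h hb n hD (velQ_mem h hb)
  refine (dist_le_coords (a := a) h _ _).trans_eq ?_
  rw [traj_ptQ_succ h hb, ← traj_neg, neg_ptQ_eq h, h1, h2, sub_self, abs_zero, zero_add, abs_mul,
    abs_pow]

/-- The growth factor over two steps between jumps. -/
lemma one_lt_growth (h : |lam| < 1) (hb : lam + a < -1) : 1 < -a + lam * (lam + a) := by
  have := mul_pos (one_sub_pos h) (by linarith : 0 < -1 - lam - a)
  linarith

/-- The first step is unsaturated and reverses the velocity; since `lam + a < -1`, the second falls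
back to or below `-1` and is cut off there. -/
lemma traj_two_of_small (h : |lam| < 1) (hb : lam + a < -1) {D : ℝ} (h0 : 0 < D) (h2 : D ≤ 2) :
    traj lam a (pt lam a (-1) D) 2 = pt lam a (-1) ((-a + lam * (lam + a)) * D) := by
  have h3 := mul_pos h0 (by linarith : 0 < -1 - lam - a)
  rw [traj_succ, traj_succ, traj_zero, step_pt_unsat h (by linarith) (by linarith),
    ← neg_neg (pt lam a (-1 + D) _), step_neg, neg_pt, step_pt_top h (by linarith), neg_pt]
  congr 1; ring

/-- As long as `D < 2`, two steps return to `s = -1` with `D` multiplied by a constant greater than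
1, so `D` must reach 2. -/
lemma exists_traj_jump (h : |lam| < 1) (hb : lam + a < -1) {D : ℝ} (h0 : 0 < D)
    (hD : 0 ≤ lam → D ≤ -2 * a - 2 * lam) :
    ∃ m, ∃ D' ∈ jumpVel lam a, traj lam a (pt lam a (-1) D) m = pt lam a (-1) D' := by
  by_contra! H
  set κ := -a + lam * (lam + a) with hκ
  have hκ1 : 1 < κ := one_lt_growth h hb
  have key : ∀ n, traj lam a (pt lam a (-1) D) (2 * n) = pt lam a (-1) (κ ^ n * D) ∧
      (0 ≤ lam → κ ^ n * D ≤ -2 * a - 2 * lam) ∧ κ ^ n * D < 2 := by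
    intro n
    have aux : ∀ D', 0 < D' → traj lam a (pt lam a (-1) D) (2 * n) = pt lam a (-1) D' →
        (0 ≤ lam → D' ≤ -2 * a - 2 * lam) → D' < 2 := by
      intro D' _ e hb'
      by_contra! h2
      exact H _ D' ⟨h2, hb'⟩ e
    induction n with
    | zero =>
      have e : traj lam a (pt lam a (-1) D) (2 * 0) = pt lam a (-1) D := rfl
      rw [pow_zero, one_mul]
      exact ⟨e, hD, aux D h0 e hD⟩
    | succ n ih =>
      obtain ⟨e, h1, h2⟩ := ih (fun D' _ e hb' => by
        by_contra! h2
        exact H _ D' ⟨h2, hb'⟩ e)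
      have hpos : 0 < κ ^ n * D := by positivity
      have e' : traj lam a (pt lam a (-1) D) (2 * (n + 1)) =
          pt lam a (-1) (κ ^ (n + 1) * D) := by
        rw [mul_add, mul_one, traj_add, e, traj_two_of_small h hb hpos h2.le]
        congr 1; rw [← hκ]; ring
      have hbd : 0 ≤ lam → κ ^ (n + 1) * D ≤ -2 * a - 2 * lam := by
        intro hl
        -- The upper bound survives because `2 * κ ≤ -2 * a - 2 * lam`, which amounts to `lam * (lam
        -- + a + 1) ≤ 0`.
        have h3 : κ * (κ ^ n * D) ≤ κ * 2 := by gcongr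
        have h4 := mul_nonneg hl (by linarith : 0 ≤ -1 - lam - a)
        have h5 : κ ^ (n + 1) * D = κ * (κ ^ n * D) := by ring
        rw [h5]
        linarith
      exact ⟨e', hbd, aux _ (by positivity) e' hbd⟩
  obtain ⟨n, hn⟩ := pow_unbounded_of_one_lt (2 / D) hκ1
  rw [div_lt_iff₀ h0] at hn
  linarith [(key n).2.2]

lemma convergesToOrbit_of_inward (h : |lam| < 1) (hb : lam + a < -1) {s d : ℝ} (hs : |s| ≤ 1)
    (h1 : 1 ≤ s + d) (hV : lam * d + a * (1 - s) < 0) :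
    ConvergesToOrbit lam a (pt lam a s d) (ptQ lam a) := by
  obtain ⟨hs1, hs2⟩ := abs_le.mp hs
  have e : traj lam a (pt lam a s d) 1 = -pt lam a (-1) (-(lam * d + a * (1 - s))) := by
    rw [traj_succ, traj_zero, step_pt_top h h1, neg_pt, neg_neg, neg_neg]
  refine convergesToOrbit_of_traj h hb 1 ?_
  rw [e]
  obtain ⟨m, D', hD', e'⟩ := exists_traj_jump h hb (D := -(lam * d + a * (1 - s)))
    (by linarith) fun hl => by
      have h3 := mul_le_mul_of_nonneg_left (by linarith : 1 - s ≤ d) hl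
      have h4 := mul_nonneg (by linarith : 0 ≤ -lam - a) (by linarith : 0 ≤ 1 + s)
      linarith
  refine ConvergesToOrbit.neg_ptQ h hb (convergesToOrbit_of_traj h hb m ?_)
  rw [e']
  exact convergesToOrbit_jump h hb hD'

/-- Here `(s, d)` is one unsaturated step before the first saturation. After the saturated step the
velocity is `κ * d + a * (1 - s)` with `κ = -a + lam * (lam + a) > 1`, hence negative: the point
turns inward. -/
lemma convergesToOrbit_before_saturation (h : |lam| < 1) (hb : lam + a < -1) {s d : ℝ}
    (hs : |s| ≤ 1) (hsd : |s + d| ≤ 1) (hd : d < 0) (hsat : 1 < |s + d + (lam + a) * d|) :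
    ConvergesToOrbit lam a (pt lam a s d) (ptQ lam a) := by
  obtain ⟨h1, h2⟩ := abs_le.mp hs
  obtain ⟨h3, h4⟩ := abs_le.mp hsd
  have h5 : 0 < (lam + a) * d := mul_pos_of_neg_of_neg (by linarith) hd
  have h6 : 1 < s + d + (lam + a) * d := by
    rcases lt_abs.mp hsat with h' | h' <;> linarith
  refine convergesToOrbit_of_traj h hb 1 ?_
  rw [traj_succ, traj_zero, step_pt_unsat h h3 h4]
  refine convergesToOrbit_of_inward h hb hsd h6.le ?_
  have h7 := mul_pos_of_neg_of_neg (by linarith [one_lt_growth h hb] :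
    -(-a + lam * (lam + a)) < 0) hd
  have h8 := mul_nonneg (by linarith [(abs_lt.mp h).1] : 0 ≤ -a) (by linarith : 0 ≤ 1 - s)
  linarith

/-- Unsaturated velocities grow like `|lam + a| ^ n`, while two points of the strip are at most 2
apart; so there is a last unsaturated step before saturation. -/
lemma convergesToOrbit_of_unsat (h : |lam| < 1) (hb : lam + a < -1) {s d : ℝ}
    (hs : |s| ≤ 1) (hsd : |s + d| ≤ 1) (hd : d ≠ 0) :
    ConvergesToOrbit lam a (pt lam a s d) (ptQ lam a) := by
  have hex : ∃ n s' d', traj lam a (pt lam a s d) n = pt lam a s' d' ∧ |s'| ≤ 1 ∧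
      |s' + d'| ≤ 1 ∧ d' ≠ 0 ∧ 1 < |s' + d' + (lam + a) * d'| := by
    by_contra! H
    have key : ∀ n : ℕ, ∃ s', traj lam a (pt lam a s d) n = pt lam a s' ((lam + a) ^ n * d) ∧
        |s'| ≤ 1 ∧ |s' + (lam + a) ^ n * d| ≤ 1 := by
      intro n
      induction n with
      | zero => exact ⟨s, by simp [traj_zero], hs, by simpa using hsd⟩
      | succ n ih =>
        obtain ⟨s', e, h1, h2⟩ := ih
        have hne : (lam + a) ^ n * d ≠ 0 := mul_ne_zero (pow_ne_zero _ (by linarith)) hd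
        have h3 := H n s' _ e h1 h2 hne
        obtain ⟨h4, h5⟩ := abs_le.mp h2
        have e2 : (lam + a) ^ (n + 1) * d = (lam + a) * ((lam + a) ^ n * d) := by ring
        refine ⟨s' + (lam + a) ^ n * d, ?_, h2, by rw [e2]; exact h3⟩
        rw [traj_succ, e, step_pt_unsat h h4 h5, e2]
    have h1 : 1 < |lam + a| := by rw [lt_abs]; right; linarith
    obtain ⟨n, hn⟩ := pow_unbounded_of_one_lt (2 / |d|) h1
    rw [div_lt_iff₀ (abs_pos.mpr hd), ← abs_pow, ← abs_mul] at hn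
    obtain ⟨s', -, h2, h3⟩ := key n
    have h4 : |(lam + a) ^ n * d| ≤ |s' + (lam + a) ^ n * d| + |s'| := by
      have := abs_sub (s' + (lam + a) ^ n * d) s'
      rwa [add_sub_cancel_left] at this
    linarith
  obtain ⟨n, s', d', e, h1, h2, h3, h4⟩ := hex
  refine convergesToOrbit_of_traj h hb n ?_
  rw [e]
  rcases h3.lt_or_gt with h3 | h3
  · exact convergesToOrbit_before_saturation h hb h1 h2 h3 h4
  · rw [← neg_neg (pt lam a s' d'), neg_pt]
    refine ConvergesToOrbit.neg_ptQ h hb (convergesToOrbit_before_saturation h hb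
      (by rwa [abs_neg]) ?_ (by linarith) ?_)
    · rwa [← neg_add, abs_neg]
    · have : -s' + -d' + (lam + a) * -d' = -(s' + d' + (lam + a) * d') := by ring
      rwa [this, abs_neg]

lemma converges_of_lt_neg_one (h : |lam| < 1) (hb : lam + a < -1) {z : ℝ × ℝ} (hz : z ∈ strip)
    (hne : ¬ IsEquilibrium lam a z) :
    (0 ≤ lam ∧ (ConvergesTo lam a z (ptE lam a) ∨ ConvergesTo lam a z (ptF lam a))) ∨
      ConvergesToOrbit lam a z (ptQ lam a) := by
  wlog hv : 0 < vel lam a z generalizing z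
  · have hv0 : vel lam a z ≠ 0 := fun e => hne ((isEquilibrium_iff h).mpr ⟨hz, e⟩)
    have hv' : vel lam a z < 0 := lt_of_le_of_ne (not_lt.mp hv) hv0
    have := this (neg_mem_strip.mpr hz) (by rwa [isEquilibrium_neg]) (by rw [vel_neg]; linarith)
    rw [← neg_neg z]
    rcases this with ⟨hl, h1 | h1⟩ | h1
    · refine Or.inl ⟨hl, Or.inr ?_⟩
      rw [ptF_eq_neg]; exact h1.neg
    · refine Or.inl ⟨hl, Or.inl ?_⟩
      rw [← neg_neg (ptE lam a), ← ptF_eq_neg]; exact h1.neg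
    · exact Or.inr (h1.neg_ptQ h hb)
  obtain ⟨h1, h2⟩ := abs_le.mp (show |z.2| ≤ 1 from hz)
  rcases le_or_gt (z.2 + vel lam a z) 1 with h3 | h3
  · right
    rw [← pt_eta h (a := a) z]
    exact convergesToOrbit_of_unsat h hb hz (abs_le.mpr ⟨by linarith, h3⟩) hv.ne'
  rcases lt_or_ge (lam * vel lam a z + a * (1 - z.2)) 0 with h4 | h4
  · right
    rw [← pt_eta h (a := a) z]
    exact convergesToOrbit_of_inward h hb hz h3.le h4
  · left
    have ha : 0 ≤ -a := by linarith [(abs_lt.mp h).1]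
    have hl : 0 ≤ lam := by
      by_contra! hl
      have := mul_neg_of_neg_of_pos hl hv
      have := mul_nonneg ha (by linarith : 0 ≤ 1 - z.2)
      linarith
    refine ⟨hl, Or.inl (convergesTo_of_traj 1 ?_)⟩
    rw [traj_succ, traj_zero, ← pt_eta h (a := a) z, step_pt_top h h3.le]
    exact converges_outward h hl h4

/-! ### Stability types of the two-periodic orbit and of the equilibria when `lam + a < -1`. -/

lemma stableTwoOrbitQ (h : |lam| < 1) (hb : lam + a < -1) : StableTwoOrbitQ lam a := by
  have hne : ptQ lam a ≠ -ptQ lam a := by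
    intro e
    have := congrArg Prod.snd e
    norm_num [ptQ] at this
  have hstab : IsStable lam a (-ptQ lam a) := by
    set V := -2 * a / (1 + lam) with hV
    have hV2 : 2 < V := two_lt_velQ h hb
    have hVf : -2 * a - lam * V = V := velQ_fixed h
    have ha : 0 < -a := by linarith [(abs_lt.mp h).1]
    -- This radius makes `(2 - a) * L < V - 2`. Hence the first step saturates and, since `|D - V| ≤
    -- (1 - a) * L`, the resulting jump velocity still exceeds 2.
    have hr : 0 < (V - 2) / (2 - a) := div_pos (by linarith) (by linarith)
    rw [neg_ptQ_eq h]
    refine isStable_of_linear_bound h (C := 1 - a) hr fun w hw hL n => ?_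
    rw [← hV, vel_pt h, pt_snd] at hL ⊢
    rw [lt_div_iff₀ (by linarith)] at hL
    obtain ⟨hw1, hw2⟩ := abs_le.mp (show |w.2| ≤ 1 from hw)
    set s := w.2 with hs
    set d := vel lam a w with hd
    have hx := abs_nonneg (s - -1)
    have hy := abs_nonneg (d - V)
    set L := |s - -1| + |d - V| with hLdef
    have hL0 : 0 ≤ L := by positivity
    cases n with
    | zero =>
      rw [traj_zero, traj_zero, vel_pt h, pt_snd, ← hs, ← hd, ← hLdef]
      have := mul_nonneg ha.le hL0
      linarith
    | succ n =>
      have hLa := mul_nonneg ha.le hL0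
      have hx2 := neg_abs_le (s - -1)
      have hx3 := le_abs_self (s - -1)
      have hy2 := neg_abs_le (d - V)
      have h1 : 1 ≤ s + d := by linarith
      set D := -(lam * d + a * (1 - s)) with hD
      have hDV : D - V = -lam * (d - V) + a * (s - -1) := by rw [hD]; linear_combination hVf
      have hDV' : |D - V| ≤ (1 - a) * L := by
        rw [hDV]
        refine (abs_add_le _ _).trans ?_
        rw [abs_mul, abs_mul, abs_neg, abs_of_neg (by linarith : a < 0)]
        have h2 := mul_le_mul_of_nonneg_right h.le hy
        have h3 := mul_nonneg ha.le hy
        rw [hLdef]; linarith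
      have hDmem : D ∈ jumpVel lam a := by
        refine ⟨by linarith [neg_abs_le (D - V)], fun hl => ?_⟩
        have h3 := mul_le_mul_of_nonneg_left (by linarith : 1 - s ≤ d) hl
        have h4 := mul_nonneg (by linarith : 0 ≤ -lam - a) (by linarith : 0 ≤ 1 + s)
        linarith
      have e1 : step lam a w = -pt lam a (-1) D := by
        rw [← pt_eta h (a := a) w, step_pt_top h h1, neg_pt, neg_neg, hD, neg_neg]
      have e2 : step lam a (pt lam a (-1) V) = -pt lam a (-1) V := by
        rw [step_pt_jump h hV2.le, hVf]
      obtain ⟨h5, h6⟩ := traj_jump_sub h hb n hDmem (velQ_mem h hb)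
      rw [traj_succ', traj_succ', e1, e2, traj_neg, traj_neg, vel_neg, vel_neg, Prod.snd_neg,
        Prod.snd_neg, h5, sub_self, abs_zero, zero_add, neg_sub_neg, abs_sub_comm, h6, abs_mul,
        abs_pow]
      refine le_trans ?_ hDV'
      exact mul_le_of_le_one_left (abs_nonneg _) (pow_le_one₀ (abs_nonneg _) h.le)
  refine ⟨HasPeriod.of_two ?_ ?_ ?_, step_ptQ h hb, ?_, hstab⟩
  · simp [strip, ptQ]
  · rw [step_ptQ h hb, step_neg_ptQ h hb]
  · rw [step_ptQ h hb]; exact hne.symm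
  · simpa using hstab.neg

lemma exists_le_dist_of_convergesToOrbit (h : |lam| < 1) (hb : lam + a < -1) {p : ℝ × ℝ}
    (hp : IsEquilibrium lam a p) : ∃ ε > 0, ∀ z, ConvergesToOrbit lam a z (ptQ lam a) →
      ∃ n, ε ≤ dist (traj lam a z n) p := by
  have hne : ∀ q, q ≠ -q → step lam a q = -q → 0 < dist q p := by
    intro q hq e
    refine dist_pos.mpr fun e' => hq ?_
    rw [← e, e', hp.2]
  have hQ : ∀ q : ℝ × ℝ, q.2 ≠ 0 → q ≠ -q := by
    intro q hq e
    have := congrArg Prod.snd e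
    rw [Prod.snd_neg] at this
    exact hq (by linarith)
  have h1 := hne _ (hQ (ptQ lam a) (by simp [ptQ])) (step_ptQ h hb)
  have h2 := hne _ (hQ (-ptQ lam a) (by simp [ptQ])) (by rw [step_neg_ptQ h hb, neg_neg])
  set ε := min (dist (ptQ lam a) p) (dist (-ptQ lam a) p) with hε
  have hε0 : 0 < ε := lt_min h1 h2
  refine ⟨ε / 2, half_pos hε0, fun z ⟨k, hk⟩ => ?_⟩
  obtain ⟨n, hn⟩ := (hk.eventually_lt_const (half_pos hε0)).exists
  refine ⟨n, ?_⟩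
  have h3 : ε ≤ dist (traj lam a (ptQ lam a) (n + k)) p := by
    rcases traj_ptQ_cases h hb (n + k) with e | e <;> rw [e]
    · exact min_le_left _ _
    · exact min_le_right _ _
  have h4 := dist_triangle_left (traj lam a (ptQ lam a) (n + k)) p (traj lam a z n)
  linarith

lemma not_isStable_of_lt_neg_one (h : |lam| < 1) (hb : lam + a < -1) {z : ℝ × ℝ}
    (hz : IsEquilibrium lam a z) : ¬ IsStable lam a z := by
  obtain ⟨ε, hε, H⟩ := exists_le_dist_of_convergesToOrbit h hb hz
  refine not_isStable_of_escape hz hε fun δ hδ => ?_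
  obtain ⟨η, hη, Hη⟩ := exists_dist_pt_lt (lam := lam) (a := a) z.2 hδ
  obtain ⟨h1, h2⟩ := abs_le.mp (show |z.2| ≤ 1 from hz.1)
  set ν := min (1 / 2) (η / 2) with hν
  have hν0 : 0 < ν := by positivity
  have hν1 : ν ≤ 1 / 2 := min_le_left _ _
  have hν2 : ν ≤ η / 2 := min_le_right _ _
  -- The perturbing velocity points towards the middle of the strip, so that the first step is
  -- unsaturated.
  obtain ⟨d, hd, hd0, hsd⟩ : ∃ d : ℝ, |d| < η ∧ d ≠ 0 ∧ |z.2 + d| ≤ 1 := by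
    rcases le_total z.2 0 with h3 | h3
    · exact ⟨ν, by rw [abs_of_pos hν0]; linarith, hν0.ne', abs_le.mpr ⟨by linarith, by linarith⟩⟩
    · exact ⟨-ν, by rw [abs_neg, abs_of_pos hν0]; linarith, (neg_neg_of_pos hν0).ne,
        abs_le.mpr ⟨by linarith, by linarith⟩⟩
  refine ⟨pt lam a z.2 d, hz.1, ?_, H _ (convergesToOrbit_of_unsat h hb hz.1 hsd hd0)⟩
  rw [hz.eq_pt h]
  exact Hη _ _ (by simpa using hη) hd

/-- Near `E`, points whose velocity after landing is positive slide outward and back to `E`; moving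
points whose first step is unsaturated are drawn to `±Q`. -/
lemma isSemiStable_ptE_of_lt_neg_one (h : |lam| < 1) (hl : 0 < lam) (hb : lam + a < -1) :
    IsSemiStable lam a (ptE lam a) := by
  have hv := continuous_vel (lam := lam) (a := a)
  have ha : 0 < -a := by linarith
  have ho1 : IsOpen ({w : ℝ × ℝ | |w.2| < 1} ∩ {w | 0 < lam * vel lam a w + a * (1 - w.2)}) :=
    isOpen_snd_lt.inter (isOpen_lt (by fun_prop) (by fun_prop))
  have ho2 : IsOpen ({w : ℝ × ℝ | |w.2| < 1} ∩
      ({w | |w.2 + vel lam a w| < 1} ∩ {w | vel lam a w ≠ 0})) :=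
    isOpen_snd_lt.inter ((isOpen_lt (by fun_prop) (by fun_prop)).inter
      (isOpen_ne_fun hv (by fun_prop)))
  obtain ⟨ε₀, hε₀, H₀⟩ := exists_le_dist_of_convergesToOrbit h hb (isEquilibrium_ptE (a := a) h)
  refine ⟨isEquilibrium_ptE h, _, _, ho1, ho2, inter_subset_left, inter_subset_left,
    -- The slope `(1 - a) / lam` makes the landing velocity equal to `η`; the slope `1 / 2` keeps
    -- the first step unsaturated.
    mem_frontier_ptE ho1 inter_subset_left ((1 - a) / lam) fun η h0 h1 => ?_,
    mem_frontier_ptE ho2 inter_subset_left (1 / 2) fun η h0 h1 => ?_,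
    fun ε hε => ?_, ε₀, hε₀, fun w hw => ?_⟩
  · refine ⟨?_, ?_⟩
    · change |1 - η| < 1
      rw [abs_lt]; constructor <;> linarith
    · change 0 < lam * vel lam a (pt lam a (1 - η) _) + a * (1 - (1 - η))
      rw [vel_pt h]
      have : lam * ((1 - a) / lam * η) + a * (1 - (1 - η)) = η := by field_simp; ring
      rwa [this]
  · refine ⟨?_, ?_, ?_⟩
    · change |1 - η| < 1
      rw [abs_lt]; constructor <;> linarith
    · change |1 - η + vel lam a _| < 1
      rw [vel_pt h, abs_lt]; constructor <;> linarith
    · change vel lam a _ ≠ 0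
      rw [vel_pt h]; positivity
  · obtain ⟨η, hη, Hη⟩ := exists_dist_pt_lt (lam := lam) (a := a) 1 hε
    have hcont : Continuous fun w : ℝ × ℝ => lam * vel lam a w + a * (1 - w.2) := by fun_prop
    have hE : lam * vel lam a (ptE lam a) + a * (1 - (ptE lam a).2) = 0 := by
      rw [ptE_eq, vel_pt h]; simp
    obtain ⟨δ, hδ, Hδ⟩ := Metric.continuous_iff.mp hcont (ptE lam a) η hη
    refine ⟨δ, hδ, fun w hw hd n hn => ?_⟩
    obtain ⟨m, rfl⟩ : ∃ m, n = m + 1 := ⟨n - 1, by omega⟩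
    have hV := Hδ w hd
    rw [hE, Real.dist_eq, sub_zero] at hV
    have hV0 : 0 < lam * vel lam a w + a * (1 - w.2) := hw.2
    have hw2 : w.2 < 1 := (abs_lt.mp hw.1).2
    have htop : 1 ≤ w.2 + vel lam a w := by
      have h3 : lam * (1 - w.2) < lam * vel lam a w := by
        have := mul_pos (by linarith : 0 < -a - lam) (by linarith : 0 < 1 - w.2)
        linarith
      have := lt_of_mul_lt_mul_left h3 hl.le
      linarith
    have e : step lam a w = pt lam a 1 (lam * vel lam a w + a * (1 - w.2)) := by
      conv_lhs => rw [← pt_eta h (a := a) w]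
      exact step_pt_top h htop
    rw [traj_succ', e, traj_outward h hl.le hV0.le, ptE_eq]
    refine Hη _ _ (by simpa using hη) ?_
    rw [abs_mul, abs_pow]
    exact (mul_le_of_le_one_left (abs_nonneg _) (pow_le_one₀ (abs_nonneg _) h.le)).trans_lt hV
  · obtain ⟨h1, h2, h3⟩ := hw
    refine H₀ w ?_
    rw [← pt_eta h (a := a) w]
    exact convergesToOrbit_of_unsat h hb (mem_strip_of_lt h1) (le_of_lt h2) h3

/-! ### Geometric sums and the return map

In the case `lam < 0`, `1 < lam + a` we write `lam = -l` and `a = b + l`, so that `b = lam + a`. -/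

/-- The geometric sum `1 + b + ... + b ^ (k - 1)`. -/
noncomputable def geo (b : ℝ) (k : ℕ) : ℝ := ∑ i ∈ Finset.range k, b ^ i

/-- The slope of the landing velocity after `k` unsaturated steps. -/
noncomputable def slope (b l : ℝ) (k : ℕ) : ℝ := (1 + l) * geo b (k + 1) - 1

variable {b l : ℝ}

lemma geo_zero : geo b 0 = 0 := Finset.sum_range_zero _

lemma geo_succ (k : ℕ) : geo b (k + 1) = geo b k + b ^ k := Finset.sum_range_succ _ _

lemma geo_one : geo b 1 = 1 := by simp [geo]

lemma sub_one_mul_geo (k : ℕ) : (b - 1) * geo b k = b ^ k - 1 := mul_geom_sum b k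

lemma geo_succ' (k : ℕ) : geo b (k + 1) = 1 + b * geo b k := by
  rw [geo_succ]; linear_combination -(sub_one_mul_geo (b := b) k)

lemma geo_strictMono (hb : 1 < b) : StrictMono (geo b) :=
  strictMono_nat_of_lt_succ fun k => by
    rw [geo_succ]; linarith [pow_pos (zero_lt_one.trans hb) k]

lemma geo_pos (hb : 1 < b) {k : ℕ} (hk : 0 < k) : 0 < geo b k := by
  have := geo_strictMono hb hk
  rwa [geo_zero] at this

lemma geo_nonneg (hb : 1 < b) (k : ℕ) : 0 ≤ geo b k := by
  have := (geo_strictMono hb).monotone (Nat.zero_le k)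
  rwa [geo_zero] at this

lemma natCast_le_geo (hb : 1 < b) (k : ℕ) : (k : ℝ) ≤ geo b k := by
  induction k with
  | zero => simp [geo_zero]
  | succ k ih =>
    rw [geo_succ]; push_cast
    linarith [one_le_pow₀ hb.le (n := k)]

lemma slope_eq (k : ℕ) : slope b l k = (b + l) * geo b k + l * b ^ k := by
  have h1 := geo_succ' (b := b) k
  have h2 := geo_succ (b := b) k
  unfold slope; linear_combination h1 + l * h2

lemma slope_add_pow (k : ℕ) : slope b l k + b ^ (k + 1) = (b + l) * geo b (k + 1) := by
  have := sub_one_mul_geo (b := b) (k + 1)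
  unfold slope; linear_combination -this

lemma slope_mono (hb : 1 < b) (hl : 0 < l) : Monotone (slope b l) := by
  intro i j hij
  have := (geo_strictMono hb).monotone (Nat.add_le_add_right hij 1)
  unfold slope
  have : (1 + l) * geo b (i + 1) ≤ (1 + l) * geo b (j + 1) := by gcongr
  linarith

lemma slope_pos (hb : 1 < b) (hl : 0 < l) (k : ℕ) : 0 < slope b l k := by
  rw [slope_eq]
  have := geo_nonneg hb k
  have := pow_pos (zero_lt_one.trans hb) k
  have : 0 < b := by linarith
  positivity

/-- The ratio `b ^ k / geo b k` is nonincreasing in `k`; up to the factor `2 * l` it is the height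
of the `k`-th peak of the return map. -/
lemma geo_pow_cross (hb : 1 < b) {K k : ℕ} (hKk : K ≤ k) :
    b ^ k * geo b K ≤ b ^ K * geo b k := by
  have h1 := sub_one_mul_geo (b := b) K
  have h2 := sub_one_mul_geo (b := b) k
  have h3 : b ^ K ≤ b ^ k := pow_le_pow_right₀ hb.le hKk
  have h4 : 0 < b - 1 := by linarith
  refine le_of_mul_le_mul_left ?_ h4
  have e1 : (b - 1) * (b ^ k * geo b K) = b ^ k * (b ^ K - 1) := by rw [← h1]; ring
  have e2 : (b - 1) * (b ^ K * geo b k) = b ^ K * (b ^ k - 1) := by rw [← h2]; ring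
  rw [e1, e2]; linarith

/-! ### Climbing from `s = -1` to `s = 1`, and the return map. -/

lemma traj_climb (hl0 : 0 < l) (hl1 : l < 1) (hb : 1 < b) {D : ℝ} (hD : 0 ≤ D) {k : ℕ}
    (hk : D * geo b k ≤ 2) : ∀ j ≤ k,
    traj (-l) (b + l) (pt (-l) (b + l) (-1) D) j =
      pt (-l) (b + l) (-1 + D * geo b j) (b ^ j * D) := by
  intro j
  have h : |-l| < 1 := by rw [abs_neg, abs_of_pos hl0]; exact hl1
  induction j with
  | zero => intro _; simp [traj_zero, geo_zero]
  | succ j ih =>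
    intro hj
    have h1 : D * geo b (j + 1) ≤ 2 :=
      (mul_le_mul_of_nonneg_left ((geo_strictMono hb).monotone hj) hD).trans hk
    have h2 : 0 ≤ D * geo b (j + 1) := mul_nonneg hD (geo_nonneg hb _)
    have e : -1 + D * geo b j + b ^ j * D = -1 + D * geo b (j + 1) := by rw [geo_succ]; ring
    rw [traj_succ, ih (by omega), step_pt_unsat h (by rw [e]; linarith) (by rw [e]; linarith), e]
    congr 1; ring

lemma traj_land (hl0 : 0 < l) (hl1 : l < 1) (hb : 1 < b) {D : ℝ} (hD : 0 ≤ D) {k : ℕ}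
    (hk : D * geo b k ≤ 2) (hk' : 2 ≤ D * geo b (k + 1)) :
    traj (-l) (b + l) (pt (-l) (b + l) (-1) D) (k + 1) =
      pt (-l) (b + l) 1 (2 * (b + l) - D * slope b l k) := by
  have h : |-l| < 1 := by rw [abs_neg, abs_of_pos hl0]; exact hl1
  have e : -1 + D * geo b k + b ^ k * D = -1 + D * geo b (k + 1) := by rw [geo_succ]; ring
  rw [traj_succ, traj_climb hl0 hl1 hb hD hk k le_rfl,
    step_pt_top h (by rw [e]; linarith), slope_eq]
  congr 1; ring

/-- The number of unsaturated steps from `s = -1` with velocity `D`. -/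
noncomputable def climb (b D : ℝ) : ℕ := sInf {k | 2 < D * geo b (k + 1)}

lemma climb_spec (hb : 1 < b) {D : ℝ} (hD : 0 < D) :
    D * geo b (climb b D) ≤ 2 ∧ 2 < D * geo b (climb b D + 1) := by
  have hne : {k | 2 < D * geo b (k + 1)}.Nonempty := by
    obtain ⟨k, hk⟩ := exists_nat_gt (2 / D)
    rw [div_lt_iff₀ hD] at hk
    refine ⟨k, ?_⟩
    have h1 := natCast_le_geo hb k
    have h2 := (geo_strictMono hb).monotone (Nat.le_add_right k 1)
    have h3 : D * k ≤ D * geo b (k + 1) := by gcongr; linarith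
    change 2 < D * geo b (k + 1)
    linarith
  refine ⟨?_, Nat.sInf_mem hne⟩
  rcases hk : climb b D with _ | k
  · rw [geo_zero]; norm_num
  · by_contra! h1
    have : climb b D ≤ k := Nat.sInf_le h1
    omega

lemma climb_eq (hb : 1 < b) {D : ℝ} (hD : 0 < D) {k : ℕ} (h1 : D * geo b k ≤ 2)
    (h2 : 2 < D * geo b (k + 1)) : climb b D = k := by
  obtain ⟨h3, h4⟩ := climb_spec hb hD
  have key : ∀ i j : ℕ, D * geo b i ≤ 2 → 2 < D * geo b (j + 1) → i ≤ j := by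
    intro i j hi hj
    have := (geo_strictMono hb).lt_iff_lt.mp (lt_of_mul_lt_mul_left (hi.trans_lt hj) hD.le)
    omega
  exact le_antisymm (key _ _ h3 h2) (key _ _ h1 h4)

lemma le_climb (hb : 1 < b) {D : ℝ} (hD : 0 < D) {k : ℕ} (h1 : D * geo b k ≤ 2) :
    k ≤ climb b D := by
  obtain ⟨-, h4⟩ := climb_spec hb hD
  have := (geo_strictMono hb).lt_iff_lt.mp (lt_of_mul_lt_mul_left (h1.trans_lt h4) hD.le)
  omega

/-- The velocity upon landing at `s = 1`. -/
noncomputable def land (b l D : ℝ) : ℝ := 2 * (b + l) - D * slope b l (climb b D)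

/-- The return map to the saturated level, up to the sign change. -/
noncomputable def ret (b l D : ℝ) : ℝ := if land b l D < 0 then -land b l D else l * land b l D

/-- The return time. -/
noncomputable def retTime (b l D : ℝ) : ℕ :=
  if land b l D < 0 then climb b D + 1 else climb b D + 2

lemma ret_nonneg (hl : 0 < l) (D : ℝ) : 0 ≤ ret b l D := by
  unfold ret
  split_ifs with h
  · linarith
  · exact mul_nonneg hl.le (not_lt.mp h)

lemma traj_ret (hl0 : 0 < l) (hl1 : l < 1) (hb : 1 < b) {D : ℝ} (hD : 0 < D) :
    traj (-l) (b + l) (pt (-l) (b + l) (-1) D) (retTime b l D) =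
      -pt (-l) (b + l) (-1) (ret b l D) := by
  have h : |-l| < 1 := by rw [abs_neg, abs_of_pos hl0]; exact hl1
  obtain ⟨h1, h2⟩ := climb_spec hb hD
  have e := traj_land hl0 hl1 hb hD.le h1 h2.le
  change _ = pt _ _ 1 (land b l D) at e
  unfold retTime ret
  split_ifs with hV
  · rw [e, neg_pt, neg_neg, neg_neg]
  · rw [traj_succ, e, step_pt_top h (by linarith [not_lt.mp hV]), neg_pt, neg_neg]
    congr 1; ring

/-- On the increasing half of branch `k` the return value is at most its value at the right end `D =
2 / geo b k`, the peak `2 * l * b ^ k / geo b k`. -/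
lemma neg_land_mul_geo_le {D : ℝ} {k : ℕ} (hl : 0 < l)
    (hb : 1 < b) (h1 : D * geo b k ≤ 2) :
    (D * slope b l k - 2 * (b + l)) * geo b k ≤ 2 * (l * b ^ k) := by
  have h2 := mul_le_mul_of_nonneg_right h1 (slope_pos hb hl k).le
  have h3 := slope_eq (b := b) (l := l) k
  calc _ = D * geo b k * slope b l k - 2 * (b + l) * geo b k := by ring
    _ ≤ 2 * slope b l k - 2 * (b + l) * geo b k := by linarith
    _ = 2 * (l * b ^ k) := by rw [h3]; ring

/-- The landing velocity decreases along branch `k`; the bound is its limit at the left end `D = 2 /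
geo b (k + 1)`. Multiplied by `l`, this is the peak of index `k + 1`. -/
lemma land_mul_geo_lt {D : ℝ} {k : ℕ} (hl : 0 < l) (hb : 1 < b)
    (h2 : 2 < D * geo b (k + 1)) :
    (2 * (b + l) - D * slope b l k) * geo b (k + 1) < 2 * b ^ (k + 1) := by
  have h1 := mul_lt_mul_of_pos_right h2 (slope_pos hb hl k)
  have h3 := slope_add_pow (b := b) (l := l) k
  calc _ = 2 * ((b + l) * geo b (k + 1)) - D * geo b (k + 1) * slope b l k := by ring
    _ < 2 * ((b + l) * geo b (k + 1)) - 2 * slope b l k := by linarith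
    _ = 2 * b ^ (k + 1) := by rw [← h3]; ring

/-- Far from `0` the return map decreases. -/
lemma ret_lt_self (hl0 : 0 < l) (hl1 : l < 1) (hb : 1 < b) {K : ℕ} (hK : l * geo b K ≤ 1) {D : ℝ}
    (hD : 0 < D) (hc : climb b D + 2 ≤ K ∨ climb b D + 1 = K ∧ land b l D < 0) :
    ret b l D < D := by
  obtain ⟨h1, h2⟩ := climb_spec hb hD
  set k := climb b D with hk
  have hland : land b l D = 2 * (b + l) - D * slope b l k := rfl
  have hmono : ∀ i ≤ K, l * geo b i ≤ 1 := fun i hi =>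
    (mul_le_mul_of_nonneg_left ((geo_strictMono hb).monotone hi) hl0.le).trans hK
  unfold ret
  split_ifs with hV
  · have h3 : l * b ^ k < 1 := by
      rcases Nat.eq_zero_or_pos k with h0 | h0
      · rw [h0, pow_zero, mul_one]; exact hl1
      · have h4 := hmono (k + 1) (by omega)
        rw [geo_succ, mul_add] at h4
        have := mul_pos hl0 (geo_pos hb h0)
        linarith
    have h4 : D * (l * b ^ k) < D * 1 := mul_lt_mul_of_pos_left h3 hD
    have h5 := mul_le_mul_of_nonneg_right h1 (by linarith : 0 ≤ b + l)
    rw [hland, slope_eq]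
    linarith
  · have h3 : climb b D + 2 ≤ K := by
      rcases hc with hc | hc
      · exact hc
      · exact absurd hc.2 hV
    have h4 := hmono (k + 2) h3
    rw [geo_succ, mul_add] at h4
    have h5 := mul_nonneg hl0.le (geo_nonneg hb (k + 1))
    have h6 : land b l D < D * b ^ (k + 1) := by
      have h7 := mul_lt_mul_of_pos_right h2 (by linarith : 0 < b + l)
      have h8 := slope_add_pow (b := b) (l := l) k
      have h9 : D * (slope b l k + b ^ (k + 1)) = D * ((b + l) * geo b (k + 1)) := by rw [h8]
      rw [hland]; linarith
    have h7 := mul_lt_mul_of_pos_left h6 hl0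
    have h8 := mul_le_mul_of_nonneg_left (by linarith : l * b ^ (k + 1) ≤ 1) hD.le
    linarith

/-- Each half-branch is bounded by its adjacent peak. In the cases listed that peak has index at
least `K`, and peak heights do not increase with the index. -/
lemma ret_mul_geo_le (hl0 : 0 < l) (hb : 1 < b) {K : ℕ} (hK0 : 0 < K) {D : ℝ}
    (hD : 0 < D) (hc : K ≤ climb b D ∨ climb b D + 1 = K ∧ 0 ≤ land b l D) :
    ret b l D * geo b K ≤ 2 * (l * b ^ K) := by
  obtain ⟨h1, h2⟩ := climb_spec hb hD
  set k := climb b D with hk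
  have hland : land b l D = 2 * (b + l) - D * slope b l k := rfl
  have hgK := geo_pos hb hK0
  have key : ∀ i, K ≤ i → ∀ y, 0 ≤ y → y * geo b i ≤ 2 * (l * b ^ i) →
      y * geo b K ≤ 2 * (l * b ^ K) := by
    intro i hi y hy h3
    have hgi : 0 < geo b i := geo_pos hb (by omega)
    have h4 := mul_le_mul_of_nonneg_left (geo_pow_cross hb hi) hl0.le
    have h5 := mul_le_mul_of_nonneg_right h3 hgK.le
    refine le_of_mul_le_mul_right ?_ hgi
    calc y * geo b K * geo b i = y * geo b i * geo b K := by ring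
      _ ≤ 2 * (l * b ^ i) * geo b K := h5
      _ = 2 * (l * (b ^ i * geo b K)) := by ring
      _ ≤ 2 * (l * (b ^ K * geo b i)) := by linarith
      _ = _ := by ring
  have hnn := ret_nonneg (b := b) hl0 D
  unfold ret at hnn ⊢
  split_ifs at hnn ⊢ with hV
  · have hKk : K ≤ k := by
      rcases hc with hc | hc
      · exact hc
      · exact absurd hV (not_lt.mpr hc.2)
    refine key k hKk _ hnn ?_
    have := neg_land_mul_geo_le hl0 hb h1
    rw [hland, neg_sub]; exact this
  · refine key (k + 1) (by omega) _ hnn ?_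
    have := mul_lt_mul_of_pos_left (land_mul_geo_lt hl0 hb h2) hl0
    rw [hland]; linarith

lemma ret_lt_or_le (hl0 : 0 < l) (hl1 : l < 1) (hb : 1 < b) {K : ℕ} (hK0 : 0 < K)
    (hK : l * geo b K ≤ 1) {D : ℝ} (hD : 0 < D) :
    ret b l D < D ∨ ret b l D * geo b K ≤ 2 * (l * b ^ K) := by
  rcases le_or_gt K (climb b D) with h1 | h1
  · exact Or.inr (ret_mul_geo_le hl0 hb hK0 hD (Or.inl h1))
  rcases lt_or_ge (land b l D) 0 with h2 | h2
  · refine Or.inl (ret_lt_self hl0 hl1 hb hK hD ?_)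
    by_cases h3 : climb b D + 1 = K
    · exact Or.inr ⟨h3, h2⟩
    · left; omega
  · by_cases h3 : climb b D + 1 = K
    · exact Or.inr (ret_mul_geo_le hl0 hb hK0 hD (Or.inr ⟨h3, h2⟩))
    · exact Or.inl (ret_lt_self hl0 hl1 hb hK hD (Or.inl (by omega)))

/-- The attracting fixed point of the return map. -/
noncomputable def attr (b l : ℝ) (k : ℕ) : ℝ := 2 * l * (b + l) / (1 + l * slope b l k)

/-- The return map contracts a one-sided neighbourhood of the attracting fixed point. -/
lemma ret_contract (hl0 : 0 < l) (hb : 1 < b) {k : ℕ}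
    (hK : l * geo b (k + 1) < 1) (hA : 1 < l * b ^ (k + 1)) {D : ℝ}
    (h1 : 2 < D * geo b (k + 1)) (h2 : D * geo b (k + 1) ≤ 2 * (l * b ^ (k + 1))) :
    ret b l D - attr b l k = -(l * slope b l k) * (D - attr b l k) ∧
      2 < ret b l D * geo b (k + 1) := by
  have hg : 0 < geo b (k + 1) := geo_pos hb (Nat.succ_pos k)
  have hD : 0 < D := pos_of_mul_pos_left (zero_lt_two.trans h1) hg.le
  have hs := slope_pos hb hl0 k
  have hgs := geo_succ' (b := b) k
  have hpk : b ^ k ≤ geo b (k + 1) := by rw [geo_succ]; linarith [geo_nonneg hb k]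
  have hlb : l * b ^ k < 1 := (mul_le_mul_of_nonneg_left hpk hl0.le).trans_lt hK
  have hbk := pow_pos (zero_lt_one.trans hb) k
  have hpow : b ^ (k + 1) = b * b ^ k := pow_succ' b k
  -- The whole interval up to the peak value lies on branch `k`, because `l * b ^ k < 1`.
  have hclimb : climb b D = k := by
    refine climb_eq hb hD ?_ h1
    have hgk := geo_nonneg hb k
    refine le_of_mul_le_mul_right ?_ hg
    have h3 := mul_le_mul_of_nonneg_right h2 hgk
    have h4 : l * b ^ k * (b * geo b k) ≤ 1 * (b * geo b k) := by gcongr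
    calc D * geo b k * geo b (k + 1) = D * geo b (k + 1) * geo b k := by ring
      _ ≤ 2 * (l * b ^ (k + 1)) * geo b k := h3
      _ = 2 * (l * b ^ k * (b * geo b k)) := by rw [hpow]; ring
      _ ≤ 2 * geo b (k + 1) := by rw [hgs]; linarith
  have hls : l * slope b l k < 1 := by
    unfold slope
    have : l * ((1 + l) * geo b (k + 1) - 1) = (1 + l) * (l * geo b (k + 1)) - l := by ring
    rw [this]
    have : (1 + l) * (l * geo b (k + 1)) < (1 + l) * 1 := by gcongr
    linarith
  have hland : land b l D = 2 * (b + l) - D * slope b l k := by rw [land, hclimb]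
  have hpos : 0 < land b l D := by
    rw [hland, sub_pos]
    refine lt_of_mul_lt_mul_right ?_ hg.le
    have h3 := mul_le_mul_of_nonneg_right h2 hs.le
    have h4 : l * slope b l k * b ^ (k + 1) < 1 * b ^ (k + 1) := by gcongr
    have h5 : b * b ^ k ≤ b * geo b (k + 1) := by gcongr
    have h6 := mul_pos hl0 hg
    calc D * slope b l k * geo b (k + 1) = D * geo b (k + 1) * slope b l k := by ring
      _ ≤ 2 * (l * b ^ (k + 1)) * slope b l k := h3
      _ = 2 * (l * slope b l k * b ^ (k + 1)) := by ring
      _ < 2 * (b + l) * geo b (k + 1) := by rw [hpow] at *; linarith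
  have hret : ret b l D = l * (2 * (b + l) - D * slope b l k) := by
    rw [ret, if_neg (not_lt.mpr hpos.le), hland]
  have hden : 0 < 1 + l * slope b l k := by positivity
  have hfix : attr b l k * (1 + l * slope b l k) = 2 * l * (b + l) := by
    rw [attr, div_mul_cancel₀ _ hden.ne']
  set ρ := l * slope b l k with hρ
  have hρ0 : 0 < ρ := mul_pos hl0 hs
  set A := attr b l k
  have heq : ret b l D - A = -ρ * (D - A) := by
    rw [hret]; linear_combination -hfix + D * hρ
  refine ⟨heq, ?_⟩
  set G := geo b (k + 1) with hG
  have hAG : 2 < A * G := by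
    have hgeo := sub_one_mul_geo (b := b) (k + 1)
    refine lt_of_mul_lt_mul_right (a := 1 + ρ) ?_ hden.le
    have e1 : A * G * (1 + ρ) = 2 * l * (b + l) * G := by rw [← hfix]; ring
    have e2 : ρ = l * ((1 + l) * G - 1) := rfl
    rw [e1, e2]
    have e3 : l * ((b - 1) * G) = l * (b ^ (k + 1) - 1) := by rw [hgeo]
    linarith
  -- The lower end `2 / G` is sent to the upper end, the peak value, by the affine branch. Since `ρ
  -- < 1`, points up to the upper end are then sent strictly above the lower end.
  have hMA : 2 * (l * b ^ (k + 1)) - A * G = ρ * (A * G - 2) := by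
    have h3 := slope_add_pow (b := b) (l := l) k
    rw [← hG] at h3
    have e1 : A * G * (1 + ρ) = 2 * l * (b + l) * G := by rw [← hfix]; ring
    have e4 : l * (slope b l k + b ^ (k + 1)) = l * ((b + l) * G) := by rw [h3]
    rw [mul_add, ← hρ] at e4
    linarith
  have h4 : D * G - A * G ≤ ρ * (A * G - 2) := by linarith
  have h5 := mul_le_mul_of_nonneg_left h4 hρ0.le
  have h6 : ρ * (ρ * (A * G - 2)) < A * G - 2 := by
    have h7 : ρ * (A * G - 2) < 1 * (A * G - 2) := by gcongr
    have h8 : ρ * (ρ * (A * G - 2)) < ρ * (1 * (A * G - 2)) := by gcongr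
    linarith
  have h7 : ret b l D * G = A * G - ρ * (D * G - A * G) := by
    linear_combination G * heq
  rw [h7]; linarith

/-- Near `0` the return map expands, and the return time is locally constant. -/
lemma ret_expand (hl0 : 0 < l) (hl1 : l < 1) (hb : 1 < b) {K : ℕ} {D : ℝ} (hD : 0 < D)
    (hDK : D * geo b K ≤ 2) (hne : ret b l D ≠ 0) :
    ∀ᶠ D' in 𝓝 D, D' * geo b K ≤ 2 → retTime b l D' = retTime b l D ∧
      l * slope b l K * |D' - D| ≤ |ret b l D' - ret b l D| := by
  obtain ⟨h1, h2⟩ := climb_spec hb hD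
  have hKk := le_climb hb hD hDK
  set k := climb b D with hk
  have hland : land b l D = 2 * (b + l) - D * slope b l k := rfl
  have hslope : ∀ i, K ≤ i → l * slope b l K ≤ l * slope b l i := fun i hi =>
    mul_le_mul_of_nonneg_left (slope_mono hb hl0 hi) hl0.le
  have hslope' : ∀ i, K ≤ i → l * slope b l K ≤ slope b l i := fun i hi =>
    (hslope i hi).trans (mul_le_of_le_one_left (slope_pos hb hl0 i).le hl1.le)
  have hneg_branch : ∀ D' : ℝ, climb b D' = k → land b l D' < 0 → land b l D < 0 →
      retTime b l D' = retTime b l D ∧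
        l * slope b l K * |D' - D| ≤ |ret b l D' - ret b l D| := by
    intro D' hc hV' hV
    have hland' : land b l D' = 2 * (b + l) - D' * slope b l k := by rw [land, hc]
    refine ⟨by rw [retTime, retTime, if_pos hV', if_pos hV, hc], ?_⟩
    have e : ret b l D' - ret b l D = slope b l k * (D' - D) := by
      rw [ret, ret, if_pos hV', if_pos hV, hland, hland']; ring
    rw [e, abs_mul, abs_of_pos (slope_pos hb hl0 k)]
    exact mul_le_mul_of_nonneg_right (hslope' k hKk) (abs_nonneg _)
  have hE0 : ∀ᶠ D' in 𝓝 D, 0 < D' := eventually_gt_nhds hD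
  have hE2 : ∀ᶠ D' in 𝓝 D, 2 < D' * geo b (k + 1) :=
    (continuous_id.mul continuous_const).continuousAt.eventually_const_lt h2
  have hEV : ∀ i : ℕ, Continuous fun D' : ℝ => 2 * (b + l) - D' * slope b l i := fun i => by
    fun_prop
  rcases lt_or_ge (land b l D) 0 with hV | hV
  · have hE3 : ∀ᶠ D' in 𝓝 D, 2 * (b + l) - D' * slope b l k < 0 :=
      (hEV k).continuousAt.eventually_lt_const hV
    rcases h1.lt_or_eq with h1 | h1
    · have hE1 : ∀ᶠ D' in 𝓝 D, D' * geo b k < 2 :=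
        (continuous_id.mul continuous_const).continuousAt.eventually_lt_const h1
      filter_upwards [hE0, hE1, hE2, hE3] with D' h0' h1' h2' h3' _
      have hc := climb_eq hb h0' h1'.le h2'
      exact hneg_branch D' hc (by rw [land, hc]; exact h3') hV
    -- At a breakpoint `D * geo b k = 2`, points just above `D` climb one step fewer but land with
    -- positive velocity and need one more step. The return time therefore agrees, and so do the
    -- return values in the limit.
    · have hk0 : 0 < k := by
        rcases Nat.eq_zero_or_pos k with h0 | h0
        · rw [h0, geo_zero, mul_zero] at h1; norm_num at h1
        · exact h0
      obtain ⟨i, hi⟩ : ∃ i, k = i + 1 := ⟨k - 1, by omega⟩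
      have hs1 := slope_eq (b := b) (l := l) k
      have hs2 := slope_add_pow (b := b) (l := l) i
      rw [← hi] at hs2
      have hVi : 2 * (b + l) - D * slope b l i = D * b ^ k := by
        linear_combination (-(b + l)) * h1 - D * hs2
      have hE1 : ∀ᶠ D' in 𝓝 D, D' * geo b i < 2 := by
        refine (continuous_id.mul continuous_const).continuousAt.eventually_lt_const ?_
        change D * geo b i < 2
        rw [← h1]
        exact mul_lt_mul_of_pos_left (geo_strictMono hb (by omega)) hD
      have hE4 : ∀ᶠ D' in 𝓝 D, 0 < 2 * (b + l) - D' * slope b l i := by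
        refine (hEV i).continuousAt.eventually_const_lt ?_
        change 0 < 2 * (b + l) - D * slope b l i
        rw [hVi]; exact mul_pos hD (pow_pos (by linarith) k)
      filter_upwards [hE0, hE1, hE2, hE3, hE4] with D' h0' h1' h2' h3' h4' hD'K
      rcases le_or_gt (D' * geo b k) 2 with h5 | h5
      · have hc := climb_eq hb h0' h5 h2'
        exact hneg_branch D' hc (by rw [land, hc]; exact h3') hV
      · have hiK : K ≤ i := by
          by_contra! hlt
          have : K = k := by omega
          rw [this] at hD'K
          linarith
        have hc : climb b D' = i := climb_eq hb h0' h1'.le (by rwa [← hi])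
        have hland' : land b l D' = 2 * (b + l) - D' * slope b l i := by rw [land, hc]
        have hV' : ¬ land b l D' < 0 := by rw [hland']; exact not_lt.mpr h4'.le
        refine ⟨?_, ?_⟩
        · rw [retTime, retTime, if_neg hV', if_pos hV, hc, ← hk, hi]
        · have e : ret b l D' - ret b l D = -(l * slope b l i) * (D' - D) := by
            rw [ret, ret, if_neg hV', if_pos hV, hland, hland']
            linear_combination l * hVi - D * hs1 - (b + l) * h1
          rw [e, abs_mul, abs_neg, abs_of_pos (mul_pos hl0 (slope_pos hb hl0 i))]
          exact mul_le_mul_of_nonneg_right (hslope i hiK) (abs_nonneg _)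
  · have hV0 : 0 < land b l D := by
      refine lt_of_le_of_ne hV fun e => hne ?_
      rw [ret, if_neg (not_lt.mpr hV), ← e, mul_zero]
    have h1 : D * geo b k < 2 := by
      refine lt_of_le_of_ne h1 fun e => ?_
      have hs1 := slope_eq (b := b) (l := l) k
      have : land b l D = -(D * (l * b ^ k)) := by
        rw [hland]; linear_combination (-(b + l)) * e - D * hs1
      have := mul_pos hD (mul_pos hl0 (pow_pos (by linarith : 0 < b) k))
      linarith
    have hE1 : ∀ᶠ D' in 𝓝 D, D' * geo b k < 2 :=
      (continuous_id.mul continuous_const).continuousAt.eventually_lt_const h1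
    have hE3 : ∀ᶠ D' in 𝓝 D, 0 < 2 * (b + l) - D' * slope b l k :=
      (hEV k).continuousAt.eventually_const_lt hV0
    filter_upwards [hE0, hE1, hE2, hE3] with D' h0' h1' h2' h3' _
    have hc := climb_eq hb h0' h1'.le h2'
    have hland' : land b l D' = 2 * (b + l) - D' * slope b l k := by rw [land, hc]
    have hV' : ¬ land b l D' < 0 := by rw [hland']; exact not_lt.mpr h3'.le
    refine ⟨by rw [retTime, retTime, if_neg hV', if_neg (not_lt.mpr hV), hc], ?_⟩
    have e : ret b l D' - ret b l D = -(l * slope b l k) * (D' - D) := by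
      rw [ret, ret, if_neg hV', if_neg (not_lt.mpr hV), hland, hland']; ring
    rw [e, abs_mul, abs_neg, abs_of_pos (mul_pos hl0 (slope_pos hb hl0 k))]
    exact mul_le_mul_of_nonneg_right (hslope k hKk) (abs_nonneg _)

/-! ### Periodic orbits of all large periods -/

/-- The quotients solve `D₂ = D₁ * slope j - 2 * (b + l)` and `D₁ = D₂ * slope k - 2 * (b + l)`: a
2-cycle of the return map with both landings inward. -/
lemma neg_land_pair {j k : ℕ} (hP : 1 < slope b l j * slope b l k) :
    2 * (b + l) - 2 * (b + l) * (1 + slope b l k) / (slope b l j * slope b l k - 1) * slope b l j =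
      -(2 * (b + l) * (1 + slope b l j) / (slope b l j * slope b l k - 1)) := by
  have : slope b l j * slope b l k - 1 ≠ 0 := by linarith
  rw [div_mul_eq_mul_div, ← neg_div, sub_eq_iff_eq_add, ← add_div, eq_div_iff this]
  ring

/-- These inequalities place the solution on branch `j`. The first needs a long partner climb `k`:
`l * slope b l k` must dominate `geo b j / b ^ j`, which stays below `1 / (b - 1)`. -/
lemma pair_bounds (hl0 : 0 < l) (hb : 1 < b) {j k : ℕ} (hP : 1 < slope b l j * slope b l k)
    (hC : (b + l) / (b - 1) + 1 ≤ l * slope b l k) :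
    2 * (b + l) * (1 + slope b l k) / (slope b l j * slope b l k - 1) * geo b j ≤ 2 ∧
    2 ≤ 2 * (b + l) * (1 + slope b l k) / (slope b l j * slope b l k - 1) * geo b (j + 1) := by
  have hP' : 0 < slope b l j * slope b l k - 1 := by linarith
  have hj := slope_pos hb hl0 j
  have hk := slope_pos hb hl0 k
  have hbl : 0 < b + l := by linarith
  have hb1 : 0 < b - 1 := by linarith
  constructor
  · rw [div_mul_eq_mul_div, div_le_iff₀ hP']
    have hpow := one_le_pow₀ hb.le (n := j)
    have h1 : geo b j ≤ b ^ j / (b - 1) := by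
      rw [le_div_iff₀ hb1]; linarith [sub_one_mul_geo (b := b) j]
    have h2 : (b + l) * geo b j ≤ (b + l) / (b - 1) * b ^ j := by
      calc _ ≤ (b + l) * (b ^ j / (b - 1)) := by gcongr
        _ = _ := by ring
    have h3 : ((b + l) / (b - 1) + 1) * b ^ j ≤ l * slope b l k * b ^ j := by gcongr
    have h4 := slope_eq (b := b) (l := l) j
    have h5 : slope b l j * slope b l k =
        (b + l) * geo b j * slope b l k + l * slope b l k * b ^ j := by rw [h4]; ring
    rw [h5]; linarith
  · have h1 : slope b l j ≤ (b + l) * geo b (j + 1) := by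
      rw [← slope_add_pow]; linarith [pow_pos (zero_lt_one.trans hb) (j + 1)]
    rw [div_mul_eq_mul_div, le_div_iff₀ hP']
    have h2 := mul_le_mul_of_nonneg_right h1 (by linarith : 0 ≤ 1 + slope b l k)
    linarith

/-- Fixing one long climb of length `J` and varying the other, `k ≥ J`, the 2-cycle of the return
map has period `(J + 1) + (k + 1)`, which covers all large integers. -/
lemma exists_hasPeriod (hl0 : 0 < l) (hl1 : l < 1) (hb : 1 < b) :
    ∃ N : ℕ, ∀ n ≥ N, 0 < n → ∃ z, HasPeriod (-l) (b + l) n z := by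
  have h : |-l| < 1 := by rw [abs_neg, abs_of_pos hl0]; exact hl1
  set C := (b + l) / (b - 1) + 1 with hC
  have hC1 : 1 < C := by
    have : 0 < (b + l) / (b - 1) := div_pos (by linarith) (by linarith)
    linarith
  obtain ⟨J, hJ⟩ := exists_nat_ge (C / l)
  have hslope : ∀ k ≥ J, C ≤ l * slope b l k := by
    intro k hk
    rw [div_le_iff₀ hl0] at hJ
    have h1 : (J : ℝ) ≤ slope b l J := by
      rw [slope_eq]
      have h2 := natCast_le_geo hb J
      have h3 := mul_pos hl0 (pow_pos (zero_lt_one.trans hb) J)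
      have h4 := mul_le_mul_of_nonneg_right (by linarith : 1 ≤ b + l) (geo_nonneg hb J)
      linarith
    have h5 := mul_le_mul_of_nonneg_left (h1.trans (slope_mono hb hl0 hk)) hl0.le
    linarith
  have hone : ∀ k ≥ J, 1 < slope b l k := fun k hk => by
    have := mul_le_of_le_one_left (slope_pos hb hl0 k).le hl1.le
    linarith [hslope k hk]
  refine ⟨2 * J + 2, fun n hn hn0 => ?_⟩
  obtain ⟨k, hk, rfl⟩ : ∃ k ≥ J, n = J + 1 + (k + 1) := ⟨n - J - 2, by omega, by omega⟩
  have hP : 1 < slope b l J * slope b l k :=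
    one_lt_mul_of_lt_of_le (hone J le_rfl) (hone k hk).le
  have hP2 : 1 < slope b l k * slope b l J := by rwa [mul_comm]
  obtain ⟨h1, h2⟩ := pair_bounds hl0 hb hP (hslope k hk)
  obtain ⟨h3, h4⟩ := pair_bounds hl0 hb hP2 (hslope J le_rfl)
  have e1 := neg_land_pair (b := b) (l := l) hP
  have e2 := neg_land_pair (b := b) (l := l) hP2
  rw [mul_comm (slope b l k) (slope b l J)] at h3 h4 e2
  have hpos : ∀ i, 0 < 2 * (b + l) * (1 + slope b l i) / (slope b l J * slope b l k - 1) := by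
    intro i
    have := slope_pos hb hl0 i
    have : 0 < slope b l J * slope b l k - 1 := by linarith
    have : 0 < b + l := by linarith
    positivity
  have hD1 := hpos k
  have hD2 := hpos J
  set D₁ := 2 * (b + l) * (1 + slope b l k) / (slope b l J * slope b l k - 1)
  set D₂ := 2 * (b + l) * (1 + slope b l J) / (slope b l J * slope b l k - 1)
  set w := pt (-l) (b + l) (-1) D₁ with hw
  have t1 : traj (-l) (b + l) w (J + 1) = -pt (-l) (b + l) (-1) D₂ := by
    rw [traj_land hl0 hl1 hb hD1.le h1 h2, e1, neg_pt, neg_neg]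
  have t2 : traj (-l) (b + l) w (J + 1 + (k + 1)) = w := by
    rw [traj_add, t1, traj_neg, traj_land hl0 hl1 hb hD2.le h3 h4, e2, neg_pt, neg_neg]
  have hper : Function.IsPeriodicPt (step (-l) (b + l)) (J + 1 + (k + 1)) w := t2
  refine ⟨w, by rw [hw, pt_mem_strip]; norm_num, hn0, ?_⟩
  set m := Function.minimalPeriod (step (-l) (b + l)) w with hm
  have hm0 : 0 < m := hper.minimalPeriod_pos hn0
  refine le_antisymm (hper.minimalPeriod_le hn0) ?_
  have hmw : traj (-l) (b + l) w m = w := Function.iterate_minimalPeriod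
  by_contra! hlt
  -- No earlier return: during the first climb `s > -1`, at its end `s = 1`, and during the second
  -- the velocity is negative.
  rcases lt_trichotomy m (J + 1) with h5 | h5 | h5
  · rw [traj_climb hl0 hl1 hb hD1.le h1 m (by omega)] at hmw
    have := (pt_injective h hmw).1
    have := mul_pos hD1 (geo_pos hb hm0)
    linarith
  · rw [h5, t1, neg_pt] at hmw
    have := (pt_injective h hmw).1
    norm_num at this
  · obtain ⟨i, hi⟩ := Nat.exists_eq_add_of_lt h5
    have hi' : m = J + 1 + (i + 1) := by omega
    rw [hi', traj_add, t1, traj_neg, traj_climb hl0 hl1 hb hD2.le h3 (i + 1) (by omega),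
      neg_pt] at hmw
    have := (pt_injective h hmw).2
    have := mul_pos (pow_pos (zero_lt_one.trans hb) (i + 1)) hD2
    linarith

/-! ### Cycles of the return map -/

lemma ret_iterate_mod {D : ℝ} {p : ℕ} (hper : (ret b l)^[p] D = D) (j : ℕ) :
    (ret b l)^[j % p] D = (ret b l)^[j] D :=
  Function.IsPeriodicPt.iterate_mod_apply hper j

/-- A cycle of the return map either contains the attracting fixed point or lies in the region
where the map expands. -/
lemma cycle_dichotomy (hl0 : 0 < l) (hl1 : l < 1) (hb : 1 < b) {k : ℕ}
    (hK : l * geo b (k + 1) ≤ 1) (hres : ¬ (l * geo b (k + 1) = 1 ∧ 1 < l * b ^ (k + 1)))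
    {D : ℝ} {p : ℕ} (hp : 0 < p) (hper : (ret b l)^[p] D = D)
    (hpos : ∀ j, 0 < (ret b l)^[j] D) :
    (ret b l (attr b l k) = attr b l k ∧ ∃ j, (ret b l)^[j] D = attr b l k) ∨
    ((∀ j, (ret b l)^[j] D * geo b (k + 1) ≤ 2) ∧
      (l * b ^ (k + 1) ≤ 1 ∨ ∀ j, (ret b l)^[j] D * geo b (k + 1) < 2)) := by
  have hG : 0 < geo b (k + 1) := geo_pos hb (Nat.succ_pos k)
  have hsucc : ∀ j, (ret b l)^[j + 1] D = ret b l ((ret b l)^[j] D) :=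
    fun j => Function.iterate_succ_apply' _ _ _
  have hshift : ∀ j, (ret b l)^[j + p] D = (ret b l)^[j] D := fun j => by
    rw [Function.iterate_add_apply, hper]
  obtain ⟨m, hmem, hmax⟩ := Finset.exists_max_image (Finset.range p)
    (fun j => (ret b l)^[j] D) ⟨0, Finset.mem_range.mpr hp⟩
  have hmax' : ∀ j, (ret b l)^[j] D ≤ (ret b l)^[m] D := fun j => by
    rw [← ret_iterate_mod hper j]
    exact hmax _ (Finset.mem_range.mpr (Nat.mod_lt _ hp))
  -- The largest element of the cycle is the image of an element that does not exceed it, so the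
  -- alternative `ret D < D` fails there and the peak bound holds.
  have hbound : ∀ j, (ret b l)^[j] D * geo b (k + 1) ≤ 2 * (l * b ^ (k + 1)) := by
    intro j
    refine (mul_le_mul_of_nonneg_right (hmax' j) hG.le).trans ?_
    have e : (ret b l)^[m] D = ret b l ((ret b l)^[m + p - 1] D) := by
      rw [← hsucc, Nat.sub_add_cancel (by omega), hshift]
    rcases ret_lt_or_le hl0 hl1 hb (Nat.succ_pos k) hK (hpos (m + p - 1)) with h1 | h1
    · rw [← e] at h1
      exact absurd (hmax' (m + p - 1)) (not_le.mpr h1)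
    · rw [e]; exact h1
  rcases le_or_gt (l * b ^ (k + 1)) 1 with hB | hA
  · exact Or.inr ⟨fun j => (hbound j).trans (by linarith), Or.inl hB⟩
  have hK' : l * geo b (k + 1) < 1 := lt_of_le_of_ne hK fun e => hres ⟨e, hA⟩
  by_cases hex : ∃ j, 2 < (ret b l)^[j] D * geo b (k + 1)
  · obtain ⟨j, hj⟩ := hex
    suffices hfix : (ret b l)^[j] D = attr b l k by
      have h1 := (ret_contract hl0 hb hK' hA hj (hbound j)).1
      rw [hfix, sub_self, mul_zero] at h1
      exact Or.inl ⟨sub_eq_zero.mp h1, j, hfix⟩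
    -- Once above the breakpoint the cycle stays there, and its distance to `attr` is multiplied by
    -- a factor of modulus less than 1. Periodicity forces the distance to be 0.
    have key : ∀ i, 2 < (ret b l)^[j + i] D * geo b (k + 1) ∧
        (ret b l)^[j + i] D - attr b l k =
          (-(l * slope b l k)) ^ i * ((ret b l)^[j] D - attr b l k) := by
      intro i
      induction i with
      | zero => exact ⟨hj, by simp⟩
      | succ i ih =>
        obtain ⟨h1, h2⟩ := ret_contract hl0 hb hK' hA ih.1 (hbound (j + i))
        rw [← add_assoc, hsucc]
        refine ⟨h2, ?_⟩
        rw [h1, ih.2, pow_succ]; ring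
    have h1 := (key p).2
    rw [hshift] at h1
    have hρ0 : 0 < l * slope b l k := mul_pos hl0 (slope_pos hb hl0 k)
    have hρ1 : l * slope b l k < 1 := by
      have e : l * slope b l k = (1 + l) * (l * geo b (k + 1)) - l := by unfold slope; ring
      have : (1 + l) * (l * geo b (k + 1)) < (1 + l) * 1 := by gcongr
      linarith
    have hlt : |(-(l * slope b l k)) ^ p| < 1 := by
      rw [abs_pow, abs_neg, abs_of_pos hρ0]
      exact pow_lt_one₀ hρ0.le hρ1 hp.ne'
    have hne : 1 - (-(l * slope b l k)) ^ p ≠ 0 := by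
      intro e
      rw [← sub_eq_zero.mp e, abs_one] at hlt
      exact lt_irrefl _ hlt
    have : (1 - (-(l * slope b l k)) ^ p) * ((ret b l)^[j] D - attr b l k) = 0 := by
      linear_combination h1
    have := (mul_eq_zero.mp this).resolve_left hne
    linarith
  · push Not at hex
    -- A point exactly at the breakpoint would be sent to the peak value, which lies above the
    -- breakpoint.
    refine Or.inr ⟨hex, Or.inr fun j => lt_of_le_of_ne (hex j) fun e => ?_⟩
    have hDj := hpos j
    have hc : climb b ((ret b l)^[j] D) = k + 1 := by
      refine climb_eq hb hDj e.le ?_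
      rw [← e]
      exact mul_lt_mul_of_pos_left (geo_strictMono hb (Nat.lt_succ_self _)) hDj
    have hpow := pow_pos (zero_lt_one.trans hb) (k + 1)
    have hland : land b l ((ret b l)^[j] D) =
        -((ret b l)^[j] D * (l * b ^ (k + 1))) := by
      rw [land, hc, slope_eq]
      linear_combination (-(b + l)) * e
    have hneg : land b l ((ret b l)^[j] D) < 0 := by
      rw [hland, neg_lt_zero]; positivity
    have h1 := hex (j + 1)
    rw [hsucc, ret, if_pos hneg, hland, neg_neg, mul_right_comm, e] at h1
    linarith

/-! ### Instability of cycles in the expanding region -/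

/-- A nearby start with the same return times is compared with the cycle return by return; the
velocity gap grows at least by `σ = l * slope b l K > 1` each time, so the trajectories cannot stay
close. -/
lemma not_isStable_of_expanding (hl0 : 0 < l) (hl1 : l < 1) (hb : 1 < b) {K : ℕ} (hK0 : 0 < K)
    (hK : 1 < l * geo b (K + 1)) {D : ℝ} {p : ℕ} (hp : 0 < p) (hper : (ret b l)^[p] D = D)
    (hpos : ∀ j, 0 < (ret b l)^[j] D) (hle : ∀ j, (ret b l)^[j] D * geo b K ≤ 2)
    (hdom : l * b ^ K ≤ 1 ∨ ∀ j, (ret b l)^[j] D * geo b K < 2) :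
    ¬ IsStable (-l) (b + l) (pt (-l) (b + l) (-1) D) := by
  have h : |-l| < 1 := by rw [abs_neg, abs_of_pos hl0]; exact hl1
  have hsucc : ∀ j, (ret b l)^[j + 1] D = ret b l ((ret b l)^[j] D) :=
    fun j => Function.iterate_succ_apply' _ _ _
  have hσ : 1 < l * slope b l K := by
    have e : l * slope b l K = (1 + l) * (l * geo b (K + 1)) - l := by unfold slope; ring
    have : (1 + l) * 1 < (1 + l) * (l * geo b (K + 1)) := by gcongr
    linarith
  set σ := l * slope b l K with hσdef
  have hG : 0 < geo b K := geo_pos hb hK0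
  have hloc : ∀ j, ∀ᶠ D' in 𝓝 ((ret b l)^[j] D), 0 < D' ∧
      ((l * b ^ K ≤ 1 ∨ D' * geo b K ≤ 2) ∧ (D' * geo b K ≤ 2 →
        retTime b l D' = retTime b l ((ret b l)^[j] D) ∧
        σ * |D' - (ret b l)^[j] D| ≤ |ret b l D' - (ret b l)^[j + 1] D|)) := by
    intro j
    refine (eventually_gt_nhds (hpos j)).and (Eventually.and ?_ ?_)
    · rcases hdom with hd | hd
      · exact Eventually.of_forall fun _ => Or.inl hd
      · have : ∀ᶠ D' in 𝓝 ((ret b l)^[j] D), D' * geo b K < 2 :=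
          (continuous_id.mul continuous_const).continuousAt.eventually_lt_const (hd j)
        exact this.mono fun _ h' => Or.inr h'.le
    · rw [hsucc]
      exact ret_expand hl0 hl1 hb (hpos j) (hle j) (by rw [← hsucc]; exact (hpos _).ne')
  have hr : ∃ r > 0, ∀ j, ∀ D', |D' - (ret b l)^[j] D| < r → 0 < D' ∧
      ((l * b ^ K ≤ 1 ∨ D' * geo b K ≤ 2) ∧ (D' * geo b K ≤ 2 →
        retTime b l D' = retTime b l ((ret b l)^[j] D) ∧
        σ * |D' - (ret b l)^[j] D| ≤ |ret b l D' - (ret b l)^[j + 1] D|)) := by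
    have h1 : ∀ j, ∀ᶠ r in 𝓝[>] (0 : ℝ), ∀ D', |D' - (ret b l)^[j] D| < r → 0 < D' ∧
      ((l * b ^ K ≤ 1 ∨ D' * geo b K ≤ 2) ∧ (D' * geo b K ≤ 2 →
        retTime b l D' = retTime b l ((ret b l)^[j] D) ∧
        σ * |D' - (ret b l)^[j] D| ≤ |ret b l D' - (ret b l)^[j + 1] D|)) := by
      intro j
      obtain ⟨ε, hε, H⟩ := Metric.eventually_nhds_iff.mp (hloc j)
      filter_upwards [Ioo_mem_nhdsGT hε] with r hr D' hD'
      exact H (by rw [Real.dist_eq]; exact hD'.trans hr.2)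
    have h2 := (Filter.eventually_all_finset (Finset.range p)).mpr fun j _ => h1 j
    obtain ⟨r, hr, hr0⟩ := (h2.and self_mem_nhdsWithin).exists
    refine ⟨r, hr0, fun j => ?_⟩
    have := hr (j % p) (Finset.mem_range.mpr (Nat.mod_lt _ hp))
    rw [hsucc, ret_iterate_mod hper] at this
    rwa [hsucc]
  obtain ⟨r, hr0, hr⟩ := hr
  intro hs
  set w := pt (-l) (b + l) (-1) D with hw
  set B : ℝ := 2 + |b + l| with hB
  have hBpos : 0 < B := by positivity
  obtain ⟨δ, hδ, hstab⟩ := hs (r / B) (by positivity)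
  have hD0 : 0 < D := hpos 0
  -- The perturbation goes downward, so that it stays in the expanding region even when `D` is on
  -- its edge.
  have hcont : ∀ᶠ η in 𝓝[>] (0 : ℝ), dist (pt (-l) (b + l) (-1) (D - η)) w < δ := by
    have : Tendsto (fun η : ℝ => pt (-l) (b + l) (-1) (D - η)) (𝓝[>] 0) (𝓝 w) := by
      refine tendsto_pt tendsto_const_nhds ?_
      have : Tendsto (fun η : ℝ => D - η) (𝓝 0) (𝓝 (D - 0)) :=
        (continuous_const.sub continuous_id).tendsto 0
      rw [sub_zero] at this
      exact this.mono_left nhdsWithin_le_nhds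
    exact (Metric.tendsto_nhds.mp this) δ hδ
  obtain ⟨η, hη, hηmem⟩ := (hcont.and (Ioo_mem_nhdsGT (lt_min hD0 hr0))).exists
  obtain ⟨hη0, hη1⟩ := hηmem
  have hηD := hη1.trans_le (min_le_left _ _)
  set w' := pt (-l) (b + l) (-1) (D - η) with hw'
  have hclose : ∀ n, |vel (-l) (b + l) (traj (-l) (b + l) w' n) -
      vel (-l) (b + l) (traj (-l) (b + l) w n)| < r := by
    intro n
    have h1 := hstab w' (by rw [hw', pt_mem_strip]; norm_num) hη n
    rw [lt_div_iff₀ hBpos] at h1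
    have := abs_vel_sub_le (a := b + l) h (traj (-l) (b + l) w' n) (traj (-l) (b + l) w n)
    rw [← hB] at this
    linarith
  have key : ∀ j, ∃ T E', E' * geo b K ≤ 2 ∧ σ ^ j * η ≤ |E' - (ret b l)^[j] D| ∧
      ((traj (-l) (b + l) w T = pt (-l) (b + l) (-1) ((ret b l)^[j] D) ∧
        traj (-l) (b + l) w' T = pt (-l) (b + l) (-1) E') ∨
       (traj (-l) (b + l) w T = -pt (-l) (b + l) (-1) ((ret b l)^[j] D) ∧
        traj (-l) (b + l) w' T = -pt (-l) (b + l) (-1) E')) := by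
    intro j
    induction j with
    | zero =>
      refine ⟨0, D - η, ?_, ?_, Or.inl ⟨rfl, rfl⟩⟩
      · have := hle 0
        simp only [Function.iterate_zero, id] at this
        have := mul_pos hη0 hG
        linarith
      · rw [Function.iterate_zero, id, sub_sub_cancel_left, abs_neg, abs_of_pos hη0]; simp
    | succ j ih =>
      obtain ⟨T, E', hE'K, hgrow, htraj⟩ := ih
      have hdist : |E' - (ret b l)^[j] D| < r := by
        have h1 := hclose T
        rcases htraj with ⟨e1, e2⟩ | ⟨e1, e2⟩
        · rwa [e1, e2, vel_pt h, vel_pt h] at h1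
        · rwa [e1, e2, vel_neg, vel_neg, vel_pt h, vel_pt h, neg_sub_neg, abs_sub_comm] at h1
      obtain ⟨hE'0, -, hexp⟩ := hr j E' hdist
      obtain ⟨htime, hexp⟩ := hexp hE'K
      have t1 := traj_ret hl0 hl1 hb (hpos j)
      have t2 := traj_ret hl0 hl1 hb hE'0
      rw [← hsucc] at t1
      rw [htime] at t2
      have htraj' : (traj (-l) (b + l) w (T + retTime b l ((ret b l)^[j] D)) =
            pt (-l) (b + l) (-1) ((ret b l)^[j + 1] D) ∧
          traj (-l) (b + l) w' (T + retTime b l ((ret b l)^[j] D)) =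
            pt (-l) (b + l) (-1) (ret b l E')) ∨
         (traj (-l) (b + l) w (T + retTime b l ((ret b l)^[j] D)) =
            -pt (-l) (b + l) (-1) ((ret b l)^[j + 1] D) ∧
          traj (-l) (b + l) w' (T + retTime b l ((ret b l)^[j] D)) =
            -pt (-l) (b + l) (-1) (ret b l E')) := by
        rcases htraj with ⟨e1, e2⟩ | ⟨e1, e2⟩
        · exact Or.inr ⟨by rw [traj_add, e1, t1], by rw [traj_add, e2, t2]⟩
        · exact Or.inl ⟨by rw [traj_add, e1, traj_neg, t1, neg_neg],
            by rw [traj_add, e2, traj_neg, t2, neg_neg]⟩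
      have hdist' : |ret b l E' - (ret b l)^[j + 1] D| < r := by
        have h1 := hclose (T + retTime b l ((ret b l)^[j] D))
        rcases htraj' with ⟨e1, e2⟩ | ⟨e1, e2⟩
        · rwa [e1, e2, vel_pt h, vel_pt h] at h1
        · rwa [e1, e2, vel_neg, vel_neg, vel_pt h, vel_pt h, neg_sub_neg, abs_sub_comm] at h1
      refine ⟨_, ret b l E', ?_, ?_, htraj'⟩
      -- The perturbed point stays in the region: either the peak value itself is not above the
      -- breakpoint, or the cycle keeps a positive distance from the breakpoint.
      · rcases (hr (j + 1) _ hdist').2.1 with hd | hd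
        · refine (ret_mul_geo_le hl0 hb hK0 hE'0 (Or.inl (le_climb hb hE'0 hE'K))).trans ?_
          linarith
        · exact hd
      · calc σ ^ (j + 1) * η = σ * (σ ^ j * η) := by ring
          _ ≤ σ * |E' - (ret b l)^[j] D| := by gcongr
          _ ≤ _ := hexp
  obtain ⟨j, hj⟩ := pow_unbounded_of_one_lt (r / η) hσ
  rw [div_lt_iff₀ hη0] at hj
  obtain ⟨T, E', -, hgrow, htraj⟩ := key j
  have h1 := hclose T
  rcases htraj with ⟨e1, e2⟩ | ⟨e1, e2⟩
  · rw [e1, e2, vel_pt h, vel_pt h] at h1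
    linarith
  · rw [e1, e2, vel_neg, vel_neg, vel_pt h, vel_pt h, neg_sub_neg, abs_sub_comm] at h1
    linarith

/-! ### Uniqueness of the stable periodic orbit -/

/-- Stability pulls back by continuity of one step; going round a periodic orbit, it passes from one
point to all of them. -/
lemma IsStable.of_step {z : ℝ × ℝ} (hs : IsStable lam a (step lam a z)) : IsStable lam a z := by
  intro ε hε
  obtain ⟨δ, hδ, H⟩ := hs ε hε
  obtain ⟨δ', hδ', H'⟩ := Metric.continuous_iff.mp (continuous_step (lam := lam) (a := a)) z δ hδ
  refine ⟨min δ' ε, by positivity, fun w hw hd n => ?_⟩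
  cases n with
  | zero => exact hd.trans_le (min_le_right _ _)
  | succ n =>
    rw [traj_succ', traj_succ']
    exact H _ (step_mem_strip w) (H' w (hd.trans_le (min_le_left _ _))) n

lemma IsStable.of_traj {z : ℝ × ℝ} (n : ℕ) (hs : IsStable lam a (traj lam a z n)) :
    IsStable lam a z := by
  induction n with
  | zero => exact hs
  | succ n ih => exact ih (IsStable.of_step (by rwa [← traj_succ]))

lemma exists_traj_eq_of_periodic {z : ℝ × ℝ} {n : ℕ} (hn : 0 < n) (hz : traj lam a z n = z)
    (i : ℕ) : ∃ j, traj lam a (traj lam a z i) j = z := by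
  refine ⟨n * i - i, ?_⟩
  rw [← traj_add, Nat.add_sub_cancel' (Nat.le_mul_of_pos_left i hn)]
  exact Function.IsPeriodicPt.mul_const (m := n) (f := step lam a) (x := z) hz i

/-- A stable periodic orbit passes through the attracting fixed point of the return map. -/
lemma stable_periodic_through_attr (hl0 : 0 < l) (hl1 : l < 1) (hb : 1 < b) {k : ℕ}
    (hK : l * geo b (k + 1) ≤ 1) (hK' : 1 < l * geo b (k + 2))
    (hres : ¬ (l * geo b (k + 1) = 1 ∧ 1 < l * b ^ (k + 1)))
    {z : ℝ × ℝ} {n : ℕ} (hn : 0 < n) (hzs : z ∈ strip) (hz : traj (-l) (b + l) z n = z)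
    (hs : IsStable (-l) (b + l) z) :
    ∃ j, traj (-l) (b + l) z j = pt (-l) (b + l) (-1) (attr b l k) := by
  have h : |-l| < 1 := by rw [abs_neg, abs_of_pos hl0]; exact hl1
  have hba : -l + (b + l) = b := by ring
  have hstable : ∀ i, IsStable (-l) (b + l) (traj (-l) (b + l) z i) := fun i => by
    obtain ⟨j, hj⟩ := exists_traj_eq_of_periodic hn hz i
    exact IsStable.of_traj j (by rwa [hj])
  -- A point of zero velocity would be a stable equilibrium, and there is none for `b > 1`.
  have hvne : ∀ i, vel (-l) (b + l) (traj (-l) (b + l) z i) ≠ 0 := fun i e =>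
    not_isStable_of_one_le h (by rw [hba]; exact hb.le) _
      ((isEquilibrium_iff h).mpr ⟨traj_mem_strip hzs i, e⟩) (hstable i)
  -- the orbit meets the section
  have hsec : ∃ i D, 0 < D ∧ (traj (-l) (b + l) z i = pt (-l) (b + l) (-1) D ∨
      traj (-l) (b + l) z i = -pt (-l) (b + l) (-1) D) := by
    have main : ∀ y ∈ strip, 0 < vel (-l) (b + l) y →
        (∀ i, vel (-l) (b + l) (traj (-l) (b + l) y i) ≠ 0) →
        ∃ i D, 0 < D ∧ traj (-l) (b + l) y i = -pt (-l) (b + l) (-1) D := by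
      intro y hy hv hvn
      obtain ⟨i, s, d, e, -, -, -, h1⟩ := exists_saturating h (by rw [hba]; exact hb.le)
        (s := y.2) hy hv
      rw [pt_eta h] at e
      set d' := -l * d + (b + l) * (1 - s)
      have e1 : traj (-l) (b + l) y (i + 1) = pt (-l) (b + l) 1 d' := by
        rw [traj_succ, e, step_pt_top h h1.le]
      have hd' := hvn (i + 1)
      rw [e1, vel_pt h] at hd'
      rcases hd'.lt_or_gt with h2 | h2
      · exact ⟨i + 1, -d', by linarith, by rw [e1, neg_pt, neg_neg, neg_neg]⟩
      · refine ⟨i + 2, l * d', mul_pos hl0 h2, ?_⟩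
        rw [traj_succ, e1, step_pt_top h (by linarith), neg_pt, neg_neg]
        congr 1; ring
    have hv0 := hvne 0
    rw [traj_zero] at hv0
    rcases hv0.lt_or_gt with hv | hv
    · obtain ⟨i, D, hD, e⟩ := main (-z) (neg_mem_strip.mpr hzs) (by rw [vel_neg]; linarith)
        (fun i => by rw [traj_neg, vel_neg]; exact neg_ne_zero.mpr (hvne i))
      rw [traj_neg, neg_inj] at e
      exact ⟨i, D, hD, Or.inl e⟩
    · obtain ⟨i, D, hD, e⟩ := main z hzs hv hvne
      exact ⟨i, D, hD, Or.inr e⟩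
  obtain ⟨i₀, D₀, hD₀, hi₀⟩ := hsec
  -- all returns
  have hret : ∀ j, 0 < (ret b l)^[j] D₀ ∧ ∃ i,
      (traj (-l) (b + l) z i = pt (-l) (b + l) (-1) ((ret b l)^[j] D₀) ∨
      traj (-l) (b + l) z i = -pt (-l) (b + l) (-1) ((ret b l)^[j] D₀)) := by
    intro j
    induction j with
    | zero => exact ⟨hD₀, i₀, hi₀⟩
    | succ j ih =>
      obtain ⟨hpos, i, hi⟩ := ih
      have t := traj_ret hl0 hl1 hb hpos
      rw [Function.iterate_succ_apply']
      set E := (ret b l)^[j] D₀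
      have hi' : traj (-l) (b + l) z (i + retTime b l E) = pt (-l) (b + l) (-1) (ret b l E) ∨
          traj (-l) (b + l) z (i + retTime b l E) = -pt (-l) (b + l) (-1) (ret b l E) := by
        rcases hi with e | e
        · exact Or.inr (by rw [traj_add, e, t])
        · exact Or.inl (by rw [traj_add, e, traj_neg, t, neg_neg])
      refine ⟨lt_of_le_of_ne (ret_nonneg hl0 E) fun e0 => ?_, _, hi'⟩
      have hv := hvne (i + retTime b l E)
      rcases hi' with e | e
      · rw [e, vel_pt h] at hv; exact hv e0.symm
      · rw [e, vel_neg, vel_pt h, ← e0, neg_zero] at hv; exact hv rfl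
  -- a cycle of the return map
  have hfin : (Set.range fun j => (ret b l)^[j] D₀).Finite := by
    refine (((Finset.range n).finite_toSet).image
      (fun i => |vel (-l) (b + l) (traj (-l) (b + l) z i)|)).subset ?_
    rintro _ ⟨j, rfl⟩
    obtain ⟨hpos, i, hi⟩ := hret j
    have hmod : traj (-l) (b + l) z (i % n) = traj (-l) (b + l) z i :=
      Function.IsPeriodicPt.iterate_mod_apply (f := step (-l) (b + l)) (x := z) hz i
    refine ⟨i % n, by simpa using Nat.mod_lt i hn, ?_⟩
    simp only [hmod]
    rcases hi with e | e
    · rw [e, vel_pt h, abs_of_pos hpos]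
    · rw [e, vel_neg, vel_pt h, abs_neg, abs_of_pos hpos]
  have hninj : ¬ Function.Injective fun j => (ret b l)^[j] D₀ := fun hinj =>
    Set.infinite_range_of_injective hinj hfin
  -- The returns take values in a finite set, so two coincide, and from the first coincidence on
  -- they form a cycle.
  obtain ⟨q, p, hp, hqp⟩ : ∃ q p, 0 < p ∧ (ret b l)^[p + q] D₀ = (ret b l)^[q] D₀ := by
    simp only [Function.Injective, not_forall] at hninj
    obtain ⟨i, j, e, hij⟩ := hninj
    rcases Nat.lt_or_gt_of_ne hij with hlt | hlt
    · exact ⟨i, j - i, by omega, by rw [Nat.sub_add_cancel hlt.le]; exact e.symm⟩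
    · exact ⟨j, i - j, by omega, by rw [Nat.sub_add_cancel hlt.le]; exact e⟩
  set D := (ret b l)^[q] D₀ with hDdef
  have hiter : ∀ j, (ret b l)^[j] D = (ret b l)^[j + q] D₀ := fun j =>
    (Function.iterate_add_apply _ _ _ _).symm
  have hper : (ret b l)^[p] D = D := by rw [hiter, hqp]
  have hpos : ∀ j, 0 < (ret b l)^[j] D := fun j => by rw [hiter]; exact (hret _).1
  rcases cycle_dichotomy hl0 hl1 hb hK hres hp hper hpos with ⟨hfix, j, hj⟩ | ⟨hle, hdom⟩
  · obtain ⟨i, hi⟩ := (hret (j + q)).2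
    rw [← hiter, hj] at hi
    rcases hi with e | e
    · exact ⟨i, e⟩
    · have t := traj_ret hl0 hl1 hb (hj ▸ hpos j)
      rw [hfix] at t
      exact ⟨i + retTime b l (attr b l k), by rw [traj_add, e, traj_neg, t, neg_neg]⟩
  · exfalso
    have hns := not_isStable_of_expanding hl0 hl1 hb (Nat.succ_pos k) hK' hp hper hpos hle hdom
    obtain ⟨i, hi⟩ := (hret q).2
    rcases hi with e | e
    · exact hns (e ▸ hstable i)
    · have := (hstable i).neg
      rw [e, neg_neg] at this
      exact hns this

/-- This index separates branches: `l * slope b l j` exceeds 1 exactly when `l * geo b (j + 1)`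
does. -/
lemma exists_geo_threshold {b l : ℝ} (hl0 : 0 < l) (hl1 : l < 1) (hb : 1 < b) :
    ∃ k, l * geo b (k + 1) ≤ 1 ∧ 1 < l * geo b (k + 2) := by
  have hex : ∃ k, 1 < l * geo b (k + 2) := by
    obtain ⟨k, hk⟩ := exists_nat_gt (1 / l)
    rw [div_lt_iff₀ hl0] at hk
    refine ⟨k, hk.trans_le ?_⟩
    rw [mul_comm]
    exact mul_le_mul_of_nonneg_left ((natCast_le_geo hb k).trans
      ((geo_strictMono hb).monotone (Nat.le_add_right k 2))) hl0.le
  classical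
  refine ⟨Nat.find hex, ?_, Nat.find_spec hex⟩
  rcases hk : Nat.find hex with _ | k
  · rw [zero_add, geo_one, mul_one]; exact hl1.le
  · exact not_lt.mp (Nat.find_min hex (m := k) (by omega))

lemma stable_periodic_unique {b l : ℝ} (hl0 : 0 < l) (hl1 : l < 1) (hb : 1 < b)
    (hres : ¬ ∃ k : ℕ, (b ^ k - 1) / (b - 1) = -1 / (-l) ∧ -1 / (-l) < b ^ k)
    {m n : ℕ} {z w : ℝ × ℝ} (hz : HasPeriod (-l) (b + l) m z) (hw : HasPeriod (-l) (b + l) n w)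
    (hsz : IsStable (-l) (b + l) z) (hsw : IsStable (-l) (b + l) w) :
    ∃ j : ℕ, w = traj (-l) (b + l) z j := by
  obtain ⟨k, hk, hk'⟩ := exists_geo_threshold hl0 hl1 hb
  -- The excluded resonance is `geo b (k + 1) = 1 / l < b ^ (k + 1)`: there `l * slope b l k = 1`,
  -- so the affine branch has slope `-1` and contracts no longer.
  have hres' : ¬ (l * geo b (k + 1) = 1 ∧ 1 < l * b ^ (k + 1)) := by
    rintro ⟨h1, h2⟩
    refine hres ⟨k + 1, ?_, ?_⟩
    · rw [neg_div_neg_eq, ← sub_one_mul_geo, mul_div_cancel_left₀ _ (by linarith : b - 1 ≠ 0),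
        eq_div_iff hl0.ne', mul_comm, h1]
    · rwa [neg_div_neg_eq, div_lt_iff₀' hl0]
  have hper : ∀ {m : ℕ} {z : ℝ × ℝ}, HasPeriod (-l) (b + l) m z →
      traj (-l) (b + l) z m = z := by
    rintro m z ⟨-, -, rfl⟩
    exact Function.iterate_minimalPeriod
  obtain ⟨i, hi⟩ := stable_periodic_through_attr hl0 hl1 hb hk hk' hres' hz.2.1 hz.1 (hper hz) hsz
  obtain ⟨j, hj⟩ := stable_periodic_through_attr hl0 hl1 hb hk hk' hres' hw.2.1 hw.1 (hper hw) hsw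
  obtain ⟨q, hq⟩ := exists_traj_eq_of_periodic hw.2.1 (hper hw) j
  exact ⟨i + q, by rw [traj_add, hi, ← hj, hq]⟩

end StopMap

theorem theorem1 (lam a β : ℝ) (hβ : β = lam + a) (hlam : |lam| < 1) :
    -- (a)
    (0 ≤ lam → 1 ≤ β →
      StopMap.IsSemiStable lam a (StopMap.ptE lam a) ∧
      StopMap.IsSemiStable lam a (StopMap.ptF lam a) ∧
      (∀ z, StopMap.IsEquilibrium lam a z → z ≠ StopMap.ptE lam a → z ≠ StopMap.ptF lam a →
        ¬ StopMap.IsStable lam a z) ∧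
      (∀ z ∈ StopMap.strip, ¬ StopMap.IsEquilibrium lam a z →
        StopMap.ConvergesTo lam a z (StopMap.ptE lam a) ∨
        StopMap.ConvergesTo lam a z (StopMap.ptF lam a))) ∧
    -- (b)
    (|β| < 1 →
      (∀ z, StopMap.IsEquilibrium lam a z → StopMap.IsStable lam a z) ∧
      (∀ z ∈ StopMap.strip, ∃ q, StopMap.IsEquilibrium lam a q ∧
        StopMap.ConvergesTo lam a z q)) ∧
    -- (c)
    (0 ≤ lam → β < -1 →
      (0 < lam →
        StopMap.IsSemiStable lam a (StopMap.ptE lam a) ∧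
        StopMap.IsSemiStable lam a (StopMap.ptF lam a)) ∧
      (lam = 0 →
        ¬ StopMap.IsStable lam a (StopMap.ptE lam a) ∧
        ¬ StopMap.IsStable lam a (StopMap.ptF lam a)) ∧
      (∀ z, StopMap.IsEquilibrium lam a z → z ≠ StopMap.ptE lam a → z ≠ StopMap.ptF lam a →
        ¬ StopMap.IsStable lam a z) ∧
      StopMap.StableTwoOrbitQ lam a ∧
      (∀ z ∈ StopMap.strip, ¬ StopMap.IsEquilibrium lam a z →
        StopMap.ConvergesTo lam a z (StopMap.ptE lam a) ∨
        StopMap.ConvergesTo lam a z (StopMap.ptF lam a) ∨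
        StopMap.ConvergesToOrbit lam a z (StopMap.ptQ lam a))) ∧
    -- (d)
    (lam < 0 → β < -1 →
      (∀ z, StopMap.IsEquilibrium lam a z → ¬ StopMap.IsStable lam a z) ∧
      StopMap.StableTwoOrbitQ lam a ∧
      (∀ z ∈ StopMap.strip, ¬ StopMap.IsEquilibrium lam a z →
        StopMap.ConvergesToOrbit lam a z (StopMap.ptQ lam a))) ∧
    -- (e)
    (lam < 0 → 1 < β →
      (∀ z, StopMap.IsEquilibrium lam a z → ¬ StopMap.IsStable lam a z) ∧
      (∃ N : ℕ, ∀ n ≥ N, 0 < n → ∃ z, StopMap.HasPeriod lam a n z) ∧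
      ((¬ ∃ k : ℕ, (β ^ k - 1) / (β - 1) = -1 / lam ∧ -1 / lam < β ^ k) →
        ∀ (m n : ℕ) (z w : ℝ × ℝ), StopMap.HasPeriod lam a m z → StopMap.HasPeriod lam a n w →
          StopMap.IsStable lam a z → StopMap.IsStable lam a w →
          ∃ j : ℕ, w = StopMap.traj lam a z j)) ∧
    -- (f)
    (lam < 0 → β = 1 →
      (∀ z, StopMap.IsEquilibrium lam a z → ¬ StopMap.IsStable lam a z) ∧
      (∀ z ∈ StopMap.strip,
        (∃ n : ℕ, StopMap.traj lam a z n = StopMap.ptE lam a ∨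
          StopMap.traj lam a z n = StopMap.ptF lam a) ∨
        Tendsto (fun n => Metric.infDist (StopMap.traj lam a z n) (StopMap.segEF lam a))
          atTop (𝓝 0))) ∧
    -- (g)
    (β = -1 →
      (∀ z, StopMap.IsEquilibrium lam a z → StopMap.IsStable lam a z) ∧
      StopMap.ptQ lam a = (1, 1) ∧
      StopMap.parSigma lam a = convexHull ℝ
        {StopMap.ptE lam a, StopMap.ptQ lam a, StopMap.ptF lam a, -StopMap.ptQ lam a} ∧
      StopMap.segEF lam a ⊆ StopMap.parSigma lam a ∧
      (∀ z ∈ StopMap.segEF lam a, StopMap.IsEquilibrium lam a z) ∧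
      (∀ z ∈ StopMap.parSigma lam a \ StopMap.segEF lam a,
        StopMap.HasPeriod lam a 2 z ∧ StopMap.step lam a z ∈ StopMap.parSigma lam a ∧
        StopMap.IsStable lam a z) ∧
      (∀ z ∈ StopMap.strip, ¬ StopMap.IsEquilibrium lam a z →
        StopMap.ConvergesTo lam a z (StopMap.ptE lam a) ∨
        StopMap.ConvergesTo lam a z (StopMap.ptF lam a) ∨
        ∃ q ∈ StopMap.parSigma lam a, StopMap.HasPeriod lam a 2 q ∧
          StopMap.step lam a q ∈ StopMap.parSigma lam a ∧
          StopMap.ConvergesToOrbit lam a z q)) := by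
  subst hβ
  refine ⟨fun hl hb => StopMap.case_one_le hlam hl hb,
    fun hb => StopMap.isStable_and_converges_of_abs_lt_one hlam hb, fun hl hb => ?_,
    fun hl hb => ?_, fun hl hb => ?_, fun hl hb => ?_,
    fun hb => StopMap.case_eq_neg_one hlam hb⟩
  · refine ⟨fun hl0 => ?_, fun _ => ?_,
      fun z hz _ _ => StopMap.not_isStable_of_lt_neg_one hlam hb hz,
      StopMap.stableTwoOrbitQ hlam hb, fun z hz hne => ?_⟩
    · have hE := StopMap.isSemiStable_ptE_of_lt_neg_one hlam hl0 hb
      exact ⟨hE, by rw [StopMap.ptF_eq_neg]; exact hE.neg⟩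
    · have hE := StopMap.isEquilibrium_ptE (a := a) hlam
      refine ⟨StopMap.not_isStable_of_lt_neg_one hlam hb hE,
        StopMap.not_isStable_of_lt_neg_one hlam hb ?_⟩
      rw [StopMap.ptF_eq_neg]; exact StopMap.isEquilibrium_neg.mpr hE
    · rcases StopMap.converges_of_lt_neg_one hlam hb hz hne with ⟨-, h | h⟩ | h
      · exact Or.inl h
      · exact Or.inr (Or.inl h)
      · exact Or.inr (Or.inr h)
  · refine ⟨fun z hz => StopMap.not_isStable_of_lt_neg_one hlam hb hz,
      StopMap.stableTwoOrbitQ hlam hb, fun z hz hne => ?_⟩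
    exact (StopMap.converges_of_lt_neg_one hlam hb hz hne).resolve_left
      fun h => absurd h.1 (not_le.mpr hl)
  · refine ⟨StopMap.not_isStable_of_one_le hlam hb.le, ?_⟩
    obtain ⟨l, rfl⟩ : ∃ l, lam = -l := ⟨-lam, (neg_neg lam).symm⟩
    obtain ⟨b, rfl⟩ : ∃ b, a = b + l := ⟨a - l, by ring⟩
    have e : -l + (b + l) = b := by ring
    rw [e] at hb ⊢
    have hl0 : 0 < l := by linarith
    have hl1 : l < 1 := by linarith [(abs_lt.mp hlam).1]
    exact ⟨StopMap.exists_hasPeriod hl0 hl1 hb, fun hres m n z w hz hw hsz hsw =>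
      StopMap.stable_periodic_unique hl0 hl1 hb hres hz hw hsz hsw⟩
  · obtain ⟨h1, h2⟩ := StopMap.case_eq_one hlam hl hb
    -- Distance to the segment tends to 0 for every trajectory, including those that reach an end
    -- point.
    exact ⟨h1, fun z hz => Or.inr (h2 z hz)⟩
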